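/- Let $M$ be a smooth manifold of dimension $n\ge 2$, $\alpha=\sqrt{a_{ij}(x)y^iy^j}$ a Riemannian metric and $\beta=b_i(x)y^i$ a smooth one-form on $M$ with $b:=\|\beta\|_\alpha<b_0$ at every point, where $0<b_0\le+\infty$. Let $\phi=\phi(b^2,s)$ be a positive $C^\infty$ function on $|s|\le b<b_0$ (that is, smooth on an open neighbourhood of this region), satisfying there $$\phi-s\phi_2>0\ \text{ (if } n\ge 3),\qquad \phi-s\phi_2+(b^2-s^2)\phi_{22}>0,$$ where the indices $1$ and $2$ denote derivatives with respect to $b^2$ and $s$. Let $F=\alpha\,\phi(b^2,s)$, $s=\beta/\alpha$, be the corresponding general $(\alpha,\beta)$-metric. Suppose that $\beta$ is closed and conformal in the sense that $b_{i|j}=c\,a_{ij}$ for some function $c=c(x)$ on $M$, where $b_{i|j}$ is the covariant derivative of $\beta$ with respect to $\alpha$. With $g_{ij}=\frac12[F^2]_{y^iy^j}$, $(g^{ij})=(g_{ij})^{-1}$, $G^i=\frac14 g^{il}\{[F^2]_{x^my^l}y^m-[F^2]_{x^l}\}$, $B^i_{\ jkl}=\partial^3G^i/\partial y^j\partial y^k\partial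 y^l$ and $L_{jkl}=-\frac12 y^mg_{im}B^i_{\ jkl}$, let $J_j=g^{kl}L_{jkl}$ be the mean Landsberg curvature of $F$. Put $l^i=y^i/\alpha$, $l_j=a_{ij}l^i$ and $$\rho=\phi(\phi-s\phi_2),\qquad \eta=-\frac{\phi_{22}}{\phi-s\phi_2+(b^2-s^2)\phi_{22}},$$ $$H=\frac{\phi_{22}-2(\phi_1-s\phi_{12})}{2(\phi-s\phi_2+(b^2-s^2)\phi_{22})},\qquad E=\frac{\phi_2+2s\phi_1}{2\phi}-H\,\frac{s\phi+(b^2-s^2)\phi_2}{\phi}.$$ Then in every local coordinate system and for every $y\ne0$, $$J_j=-\frac{c\,\phi}{2\rho}\,W_j,$$ where $$\begin{aligned}W_j=\Big\{&(E-sE_2)(n+1)\phi_2+3E_{22}\phi_2(b^2-s^2)-sE_{22}(n+1)\phi+E_{222}\phi(b^2-s^2)\\ &+\big[(H_2-sH_{22})(n+1)+H_{222}(b^2-s^2)\big]\big(s\phi+(b^2-s^2)\phi_2\big)\\ &+3\eta(E-sE_2)\phi_2(b^2-s^2)+3\eta E_{22}\phi_2(b^2-s^2)^2-3s\eta E_{22}\phi(b^2-s^2)+\eta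 E_{222}(b^2-s^2)^2\phi\\ &+\eta\big[3(H_2-sH_{22})(b^2-s^2)+H_{222}(b^2-s^2)^2\big]\big(s\phi+(b^2-s^2)\phi_2\big)\Big\}(b_j-s\,l_j).\end{aligned}$$ -/

import Mathlib

open scoped Manifold ContDiff

noncomputable section

namespace GenAB

/-! ### Finsler quantities in local coordinates

`F u y` is a Finsler function written in local coordinates: `u` is the position and `y` the
components of the tangent vector.  All quantities are the usual coordinate expressions. -/

/-- The coordinate space `ℝⁿ`. -/
abbrev Coord (n : ℕ) : Type := EuclideanSpace ℝ (Fin n)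

/-- Partial derivative in the `i`-th coordinate. -/
def pd {n : ℕ} (i : Fin n) (f : Coord n → ℝ) (u : Coord n) : ℝ :=
  fderiv ℝ f u (EuclideanSpace.single i 1)

/-- Fundamental tensor `g_ij = ½ ∂²(F²)/∂yⁱ∂yʲ`. -/
def fundTensor {n : ℕ} (F : Coord n → Coord n → ℝ) (u y : Coord n) : Matrix (Fin n) (Fin n) ℝ :=
  Matrix.of fun i j => 1 / 2 * pd j (pd i fun z => F u z ^ 2) y

/-- Geodesic (spray) coefficients
`Gⁱ = ¼ gⁱˡ ( ∂²(F²)/∂xᵐ∂yˡ yᵐ - ∂(F²)/∂xˡ )`. -/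
def spray {n : ℕ} (F : Coord n → Coord n → ℝ) (u y : Coord n) (i : Fin n) : ℝ :=
  1 / 4 * ∑ l, (fundTensor F u y)⁻¹ i l *
    ((∑ m, pd m (fun v => pd l (fun z => F v z ^ 2) y) u * y m) - pd l (fun v => F v y ^ 2) u)

/-- Berwald curvature `Bⁱ_jkl = ∂³Gⁱ/∂yʲ∂yᵏ∂yˡ`. -/
def berwald {n : ℕ} (F : Coord n → Coord n → ℝ) (u y : Coord n) (i j k l : Fin n) : ℝ :=
  pd l (pd k (pd j fun z => spray F u z i)) y

/-- Landsberg curvature `L_jkl = -½ yᵐ g_im Bⁱ_jkl`. -/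
def landsberg {n : ℕ} (F : Coord n → Coord n → ℝ) (u y : Coord n) (j k l : Fin n) : ℝ :=
  -(1 / 2) * ∑ i, ∑ m, y m * fundTensor F u y i m * berwald F u y i j k l

/-- Mean Landsberg curvature `J_j = gᵏˡ L_jkl`. -/
def meanLandsberg {n : ℕ} (F : Coord n → Coord n → ℝ) (u y : Coord n) (j : Fin n) : ℝ :=
  ∑ k, ∑ l, (fundTensor F u y)⁻¹ k l * landsberg F u y j k l

/-! ### Riemannian quantities in local coordinates -/

/-- Christoffel symbols `Γᵏ_ij = ½ aᵏˡ (∂_i a_jl + ∂_j a_il - ∂_l a_ij)`. -/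
def christoffel {n : ℕ} (a : Coord n → Matrix (Fin n) (Fin n) ℝ) (u : Coord n)
    (k i j : Fin n) : ℝ :=
  1 / 2 * ∑ l, (a u)⁻¹ k l *
    (pd i (fun v => a v j l) u + pd j (fun v => a v i l) u - pd l (fun v => a v i j) u)

/-- Covariant derivative `b_{i|j} = ∂_j b_i - Γᵏ_ij b_k` with respect to the Levi-Civita
connection of `a`. -/
def covDeriv {n : ℕ} (a : Coord n → Matrix (Fin n) (Fin n) ℝ) (b : Coord n → Fin n → ℝ)
    (u : Coord n) (i j : Fin n) : ℝ :=
  pd j (fun v => b v i) u - ∑ k, christoffel a u k i j * b u k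

/-! ### The function `φ = φ(t, s)` with `t = b²` and the scalars built from it -/

/-- The region `|s| ≤ b < b₀`, in the variables `(t, s) = (b², s)`. -/
def region (b₀ : EReal) : Set (ℝ × ℝ) :=
  {p | 0 ≤ p.1 ∧ |p.2| ≤ √p.1 ∧ ((√p.1 : ℝ) : EReal) < b₀}

/-- Derivative in the first variable `t = b²`. -/
def d1 (f : ℝ → ℝ → ℝ) (t s : ℝ) : ℝ := deriv (fun r => f r s) t

/-- Derivative in the second variable `s`. -/
def d2 (f : ℝ → ℝ → ℝ) (t s : ℝ) : ℝ := deriv (fun r => f t r) s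

/-- The conditions on `φ` in the definition of a general `(α, β)`-metric in dimension `n`:
`φ` is positive and `C^∞` on the region `|s| ≤ b < b₀` (smoothness on this non-open set means
smoothness on an open neighbourhood of it), with `φ - sφ₂ > 0` (for `n ≥ 3`) and
`φ - sφ₂ + (b² - s²)φ₂₂ > 0` there. -/
structure IsAdmissible (n : ℕ) (b₀ : EReal) (φ : ℝ → ℝ → ℝ) : Prop where
  smooth : ∃ U : Set (ℝ × ℝ), IsOpen U ∧ region b₀ ⊆ U ∧
    ContDiffOn ℝ ∞ (fun p : ℝ × ℝ => φ p.1 p.2) U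
  pos : ∀ t s, (t, s) ∈ region b₀ → 0 < φ t s
  convex₁ : 3 ≤ n → ∀ t s, (t, s) ∈ region b₀ → 0 < φ t s - s * d2 φ t s
  convex₂ : ∀ t s, (t, s) ∈ region b₀ →
    0 < φ t s - s * d2 φ t s + (t - s ^ 2) * d2 (d2 φ) t s

/-- `ρ = φ(φ - sφ₂)`. -/
def rho (φ : ℝ → ℝ → ℝ) (t s : ℝ) : ℝ := φ t s * (φ t s - s * d2 φ t s)

/-- `η = -φ₂₂ / (φ - sφ₂ + (b² - s²)φ₂₂)`. -/
def eta (φ : ℝ → ℝ → ℝ) (t s : ℝ) : ℝ :=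
  -(d2 (d2 φ) t s / (φ t s - s * d2 φ t s + (t - s ^ 2) * d2 (d2 φ) t s))

/-- `H = (φ₂₂ - 2(φ₁ - sφ₁₂)) / (2(φ - sφ₂ + (b² - s²)φ₂₂))`. -/
def Hfun (φ : ℝ → ℝ → ℝ) (t s : ℝ) : ℝ :=
  (d2 (d2 φ) t s - 2 * (d1 φ t s - s * d2 (d1 φ) t s)) /
    (2 * (φ t s - s * d2 φ t s + (t - s ^ 2) * d2 (d2 φ) t s))

/-- `E = (φ₂ + 2sφ₁) / (2φ) - H (sφ + (b² - s²)φ₂) / φ`. -/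
def Efun (φ : ℝ → ℝ → ℝ) (t s : ℝ) : ℝ :=
  (d2 φ t s + 2 * s * d1 φ t s) / (2 * φ t s) -
    Hfun φ t s * ((s * φ t s + (t - s ^ 2) * d2 φ t s) / φ t s)

/-- The scalar factor of `W_j`, i.e. `W_j = Wscalar · (b_j - s l_j)`. -/
def Wscalar (n : ℕ) (φ : ℝ → ℝ → ℝ) (t s : ℝ) : ℝ :=
  let f := φ t s
  let f₂ := d2 φ t s
  let η := eta φ t s
  let D := t - s ^ 2
  let S := s * f + D * f₂
  let E := Efun φ t s
  let E₂ := d2 (Efun φ) t s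
  let E₂₂ := d2 (d2 (Efun φ)) t s
  let E₂₂₂ := d2 (d2 (d2 (Efun φ))) t s
  let H₂ := d2 (Hfun φ) t s
  let H₂₂ := d2 (d2 (Hfun φ)) t s
  let H₂₂₂ := d2 (d2 (d2 (Hfun φ))) t s
  (E - s * E₂) * (n + 1) * f₂ + 3 * E₂₂ * f₂ * D - s * E₂₂ * (n + 1) * f + E₂₂₂ * f * D
    + ((H₂ - s * H₂₂) * (n + 1) + H₂₂₂ * D) * S
    + 3 * η * (E - s * E₂) * f₂ * D + 3 * η * E₂₂ * f₂ * D ^ 2 - 3 * s * η * E₂₂ * f * D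
    + η * E₂₂₂ * D ^ 2 * f
    + η * (3 * (H₂ - s * H₂₂) * D + H₂₂₂ * D ^ 2) * S

/-! ### General `(α, β)`-metrics on a manifold -/

section Manifold

variable {n : ℕ} {M : Type*} [TopologicalSpace M] [ChartedSpace (Coord n) M]
  [IsManifold (𝓡 n) ∞ M]

/-- A smooth Riemannian metric on `M`. -/
abbrev RiemMetric (n : ℕ) (M : Type*) [TopologicalSpace M] [ChartedSpace (Coord n) M]
    [IsManifold (𝓡 n) ∞ M] : Type _ :=
  Bundle.ContMDiffRiemannianMetric (𝓡 n) ∞ (Coord n) (fun x : M => TangentSpace (𝓡 n) x)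

/-- A smooth one-form on `M`: a smooth section of the cotangent bundle. -/
abbrev OneForm (n : ℕ) (M : Type*) [TopologicalSpace M] [ChartedSpace (Coord n) M]
    [IsManifold (𝓡 n) ∞ M] : Type _ :=
  ContMDiffSection (𝓡 n) (Coord n →L[ℝ] ℝ) ∞
    (fun x : M => TangentSpace (𝓡 n) x →L[ℝ] ℝ)

/-- `α(x, v) = √(a_x(v, v))`. -/
def alphaNorm (a : RiemMetric n M) (x : M) (v : TangentSpace (𝓡 n) x) : ℝ :=
  √(a.inner x v v)

/-- `b(x) = ‖β‖_α`, the norm of the covector `β_x` dual to `α`. -/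
def formNorm (a : RiemMetric n M) (β : OneForm n M) (x : M) : ℝ :=
  sSup {r : ℝ | ∃ v : TangentSpace (𝓡 n) x, alphaNorm a x v ≤ 1 ∧ r = |β x v|}

/-- The general `(α, β)`-metric `F = α φ(b², β/α)`. -/
def metricAB (a : RiemMetric n M) (β : OneForm n M) (φ : ℝ → ℝ → ℝ)
    (x : M) (v : TangentSpace (𝓡 n) x) : ℝ :=
  alphaNorm a x v * φ (formNorm a β x ^ 2) (β x v / alphaNorm a x v)

/-- The tangent vector `yⁱ ∂/∂xⁱ` at the point with coordinates `u` in the chart `e`. -/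
def chartVec (e : OpenPartialHomeomorph M (Coord n)) (u y : Coord n) :
    TangentSpace (𝓡 n) (e.symm u) :=
  mfderiv (𝓡 n) (𝓡 n) e.symm u y

/-- The function `F` on the tangent bundle, in the local coordinates of the chart `e`. -/
def inChart (e : OpenPartialHomeomorph M (Coord n))
    (F : (x : M) → TangentSpace (𝓡 n) x → ℝ) (u y : Coord n) : ℝ :=
  F (e.symm u) (chartVec e u y)

/-- The components `a_ij` of `α` in the chart `e`. -/
def metricCoeff (a : RiemMetric n M) (e : OpenPartialHomeomorph M (Coord n)) (u : Coord n) :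
    Matrix (Fin n) (Fin n) ℝ :=
  Matrix.of fun i j => a.inner (e.symm u) (chartVec e u (EuclideanSpace.single i 1))
    (chartVec e u (EuclideanSpace.single j 1))

/-- The components `b_i` of `β` in the chart `e`. -/
def formCoeff (β : OneForm n M) (e : OpenPartialHomeomorph M (Coord n)) (u : Coord n)
    (i : Fin n) : ℝ :=
  β (e.symm u) (chartVec e u (EuclideanSpace.single i 1))

/-- `β` is closed and conformal with factor `c`: `b_{i|j} = c a_ij` in all local coordinates. -/
def IsClosedConformal (a : RiemMetric n M) (β : OneForm n M) (c : M → ℝ) : Prop :=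
  ∀ e ∈ IsManifold.maximalAtlas (𝓡 n) ∞ M, ∀ u ∈ e.target, ∀ i j : Fin n,
    covDeriv (metricCoeff a e) (formCoeff β e) u i j = c (e.symm u) * metricCoeff a e u i j

end Manifold

end GenAB

end

/-! The computation takes place in one chart at one base point. The covectors l_j and m_j = b_j - s
l_j are orthogonal for a_ij, with |l| = 1 and |m|² = D = b² - s²; let h = a - l ⊗ l be the angular
tensor. Fibre derivatives close up on these objects: ∂α = l and ∂s = m/α, while α ∂l, α ∂m and α ∂h
are polynomials in s, l, m, h.

Spray: let Nᵏ_m = Γᵏ_mi yⁱ. Since b_{i|j} = c a_ij, ∂b²/∂xᵐ = 2c b_m and ∂F²/∂xᵐ = Nᵏ_m ∂F²/∂yᵏ +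
X_m, where X_m carries the factor c (`hasPd_base_localF_sq`). In the formula for G the connection
terms reduce to 2 g_kl Γᵏ_ij yⁱyʲ. The remainder yᵐ ∂X_m/∂yˡ - X_l equals g_li applied to 4c(αE yⁱ +
α²H bⁱ), which is what E and H are designed for (`sum_mul_pd_horiz`). Hence Gⁱ = ½ Γⁱ_jk yʲyᵏ + c(αE
yⁱ + α²H bⁱ), in `spray_localF`.

Landsberg curvature: three fibre derivatives kill the quadratic term. Contracting with y_i = g_im yᵐ
= αφ(φ l_i + φ₂ m_i) cancels every term containing l and leaves -½cφ [X (h_jk m_l + h_jl m_k + h_kl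
m_j) + Z m_j m_k m_l], with scalars X, Z in φ, E, H (`landsberg_localF`).

Trace: the inverse of g is ρ⁻¹(a⁻¹ + η m ⊗ m) plus terms containing the vector l
(`fund_mul_invTensor`). Those terms vanish because h and m annihilate that vector, so the trace is
ρ⁻¹ [X(n + 1 + 3ηD) + Z(D + ηD²)] m_j (`contract`), and this is the stated formula. Division by ρ
needs φ - sφ₂ > 0 also when n = 2; `sub_mul_deriv_pos` derives it from the second convexity
condition. -/

noncomputable section

namespace GenAB

/-! ### Partial derivatives -/

/-- `f` is differentiable at `z` with `i`-th partial derivative `f'`. -/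
def HasPd {n : ℕ} (i : Fin n) (f : Coord n → ℝ) (f' : ℝ) (z : Coord n) : Prop :=
  DifferentiableAt ℝ f z ∧ pd i f z = f'

section HasPd

variable {n : ℕ} {i : Fin n} {f g : Coord n → ℝ} {f' g' : ℝ} {z : Coord n}

theorem HasPd.congr_val (h : HasPd i f f' z) (h' : f' = g') : HasPd i f g' z := h' ▸ h

theorem HasPd.congr_fun (h : HasPd i f f' z) (hg : g =ᶠ[nhds z] f) : HasPd i g f' z := by
  refine ⟨h.1.congr_of_eventuallyEq hg, ?_⟩
  rw [← h.2, pd, pd, hg.fderiv_eq]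

theorem eventually_of_forall_ne {p : Coord n → Prop} (h : ∀ w, w ≠ 0 → p w) (hz : z ≠ 0) :
    ∀ᶠ w in nhds z, p w :=
  (isOpen_ne.mem_nhds hz |> Filter.eventually_of_mem) fun w hw => h w hw

/-- The functions of y used here are smooth only off the origin. As z ≠ 0 is an open condition, a
derivative formula valid there can be differentiated again. -/
theorem HasPd.congr_ne (h : HasPd i f f' z) (hg : ∀ w, w ≠ 0 → g w = f w) (hz : z ≠ 0) :
    HasPd i g f' z :=
  h.congr_fun (eventually_of_forall_ne hg hz)

theorem hasPd_const (i : Fin n) (r : ℝ) (z : Coord n) : HasPd i (fun _ => r) 0 z := by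
  simp [HasPd, pd]

theorem hasPd_coord (i k : Fin n) (z : Coord n) :
    HasPd i (fun z => z k) (if k = i then 1 else 0) z := by
  have h : HasFDerivAt (fun z : Coord n => z k) (EuclideanSpace.proj k : Coord n →L[ℝ] ℝ) z :=
    (EuclideanSpace.proj k : Coord n →L[ℝ] ℝ).hasFDerivAt
  refine ⟨h.differentiableAt, ?_⟩
  rw [pd, h.fderiv]
  simp

theorem HasPd.add (hf : HasPd i f f' z) (hg : HasPd i g g' z) :
    HasPd i (fun w => f w + g w) (f' + g') z := by
  refine ⟨hf.1.add hg.1, ?_⟩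
  rw [pd, fderiv_fun_add hf.1 hg.1, ← hf.2, ← hg.2]
  rfl

theorem HasPd.neg (hf : HasPd i f f' z) : HasPd i (fun w => -f w) (-f') z := by
  refine ⟨hf.1.neg, ?_⟩
  rw [pd, fderiv_fun_neg, ← hf.2]
  rfl

theorem HasPd.sub (hf : HasPd i f f' z) (hg : HasPd i g g' z) :
    HasPd i (fun w => f w - g w) (f' - g') z := by
  simpa only [sub_eq_add_neg] using hf.add hg.neg

theorem HasPd.mul (hf : HasPd i f f' z) (hg : HasPd i g g' z) :
    HasPd i (fun w => f w * g w) (f' * g z + f z * g') z := by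
  refine ⟨hf.1.mul hg.1, ?_⟩
  rw [pd, fderiv_fun_mul hf.1 hg.1, ← hf.2, ← hg.2]
  simp only [add_apply, smul_apply, smul_eq_mul, pd]
  ring

theorem HasPd.const_mul (r : ℝ) (hf : HasPd i f f' z) :
    HasPd i (fun w => r * f w) (r * f') z :=
  ((hasPd_const i r z).mul hf).congr_val (by ring)

theorem HasPd.comp {k : ℝ → ℝ} {k' : ℝ} (hk : HasDerivAt k k' (f z)) (hf : HasPd i f f' z) :
    HasPd i (fun w => k (f w)) (k' * f') z := by
  have h := hk.comp_hasFDerivAt z hf.1.hasFDerivAt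
  refine ⟨h.differentiableAt, ?_⟩
  have h2 : fderiv ℝ (fun w => k (f w)) z = k' • fderiv ℝ f z := h.fderiv
  rw [pd, h2, ← hf.2]
  rfl

theorem HasPd.div (hf : HasPd i f f' z) (hg : HasPd i g g' z) (h0 : g z ≠ 0) :
    HasPd i (fun w => f w / g w) ((f' * g z - f z * g') / g z ^ 2) z := by
  have := hf.mul (HasPd.comp (hasDerivAt_inv h0) hg)
  refine this.congr_val ?_
  field_simp
  ring

theorem hasPd_sum {ι : Type*} (s : Finset ι) {f : ι → Coord n → ℝ} {f' : ι → ℝ}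
    (h : ∀ a ∈ s, HasPd i (f a) (f' a) z) :
    HasPd i (fun w => ∑ a ∈ s, f a w) (∑ a ∈ s, f' a) z := by
  classical
  induction s using Finset.induction_on with
  | empty => simpa using hasPd_const i 0 z
  | insert a s ha ih =>
    simp only [Finset.sum_insert ha]
    exact (h a (by simp)).add (ih fun b hb => h b (by simp [hb]))

/-- Chain rule for φ(b²(x), s(x, y)) when the base point moves. Joint differentiability is needed,
since `d1` and `d2` are only derivatives along the axes. -/
theorem HasPd.comp₂ {k : ℝ → ℝ → ℝ}
    (hk : DifferentiableAt ℝ (fun p : ℝ × ℝ => k p.1 p.2) (f z, g z))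
    (hf : HasPd i f f' z) (hg : HasPd i g g' z) :
    HasPd i (fun w => k (f w) (g w)) (d1 k (f z) (g z) * f' + d2 k (f z) (g z) * g') z := by
  set K := fderiv ℝ (fun p : ℝ × ℝ => k p.1 p.2) (f z, g z) with hK
  have hk' : HasFDerivAt (fun p : ℝ × ℝ => k p.1 p.2) K (f z, g z) := hk.hasFDerivAt
  have h1 : d1 k (f z) (g z) = K (1, 0) := by
    have : HasDerivAt (fun r : ℝ => (r, g z)) ((1 : ℝ), (0 : ℝ)) (f z) :=
      (hasDerivAt_id _).prodMk (hasDerivAt_const _ _)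
    exact (hk'.comp_hasDerivAt (f z) this).deriv
  have h2 : d2 k (f z) (g z) = K (0, 1) := by
    have : HasDerivAt (fun r : ℝ => (f z, r)) ((0 : ℝ), (1 : ℝ)) (g z) :=
      (hasDerivAt_const _ _).prodMk (hasDerivAt_id _)
    exact (hk'.comp_hasDerivAt (g z) this).deriv
  have h := HasFDerivAt.comp z hk' (hf.1.hasFDerivAt.prodMk hg.1.hasFDerivAt)
  refine ⟨h.differentiableAt, ?_⟩
  have h3 : fderiv ℝ (fun w => k (f w) (g w)) z = _ := h.fderiv
  rw [pd, h3, h1, h2, ← hf.2, ← hg.2]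
  simp only [ContinuousLinearMap.comp_apply, ContinuousLinearMap.prod_apply, pd]
  generalize fderiv ℝ f z (EuclideanSpace.single i 1) = x
  generalize fderiv ℝ g z (EuclideanSpace.single i 1) = y
  have : ((x, y) : ℝ × ℝ) = x • (1, 0) + y • (0, 1) := by simp
  rw [this, map_add, map_smul, map_smul, smul_eq_mul, smul_eq_mul]
  ring

end HasPd

/-- Mixed partial derivatives of a `C²` function of `(v, z)` commute. -/
theorem pd_comm {n : ℕ} (m l : Fin n) {f : Coord n → Coord n → ℝ} {u y : Coord n}
    (hf : ContDiffAt ℝ 2 (fun p : Coord n × Coord n => f p.1 p.2) (u, y)) :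
    pd m (fun v => pd l (fun z => f v z) y) u = pd l (fun z => pd m (fun v => f v z) u) y := by
  set Φ := fun p : Coord n × Coord n => f p.1 p.2 with hΦ
  set em : Coord n := EuclideanSpace.single m 1
  set el : Coord n := EuclideanSpace.single l 1
  have hev : ∀ᶠ p in nhds (u, y), DifferentiableAt ℝ Φ p := by
    filter_upwards [hf.eventually (by simp)] with p hp using hp.differentiableAt (by simp)
  have hd : DifferentiableAt ℝ (fderiv ℝ Φ) (u, y) :=
    (hf.fderiv_right (m := 1) (by norm_num)).differentiableAt (by simp)
  have hL : HasFDerivAt (fun v : Coord n => (v, y)) (ContinuousLinearMap.inl ℝ (Coord n) (Coord n)) u :=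
    hasFDerivAt_prodMk_left u y
  have hR : HasFDerivAt (fun z : Coord n => (u, z)) (ContinuousLinearMap.inr ℝ (Coord n) (Coord n)) y :=
    hasFDerivAt_prodMk_right u y
  have e1 : (fun v => pd l (fun z => f v z) y) =ᶠ[nhds u] fun v => fderiv ℝ Φ (v, y) (0, el) := by
    filter_upwards [hL.continuousAt.eventually hev] with v hv
    have := (HasFDerivAt.comp (g := Φ) (f := fun z => (v, z)) y hv.hasFDerivAt
      (hasFDerivAt_prodMk_right v y)).fderiv
    change fderiv ℝ (Φ ∘ fun z => (v, z)) y el = _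
    rw [this]; simp
  have e2 : (fun z => pd m (fun v => f v z) u) =ᶠ[nhds y] fun z => fderiv ℝ Φ (u, z) (em, 0) := by
    filter_upwards [hR.continuousAt.eventually hev] with z hz
    have := (HasFDerivAt.comp (g := Φ) (f := fun v => (v, z)) u hz.hasFDerivAt
      (hasFDerivAt_prodMk_left u z)).fderiv
    change fderiv ℝ (Φ ∘ fun v => (v, z)) u em = _
    rw [this]; simp
  have k1 := ((hd.hasFDerivAt.comp u hL).clm_apply (hasFDerivAt_const ((0 : Coord n), el) u))
  have k2 := ((hd.hasFDerivAt.comp y hR).clm_apply (hasFDerivAt_const (em, (0 : Coord n)) y))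
  have hs : IsSymmSndFDerivAt ℝ Φ (u, y) := hf.isSymmSndFDerivAt (by simp)
  rw [pd, pd, e1.fderiv_eq, e2.fderiv_eq]
  erw [k1.fderiv, k2.fderiv]
  simpa using hs (em, 0) (0, el)

/-! ### Calculus in the fibre variable, for a fixed inner product `A` and covector `b` -/

section Fibre

variable {n : ℕ}

/-- The quadratic form `A_ij zⁱ zʲ`. -/
def quad (A : Matrix (Fin n) (Fin n) ℝ) (z : Coord n) : ℝ := ∑ i, ∑ j, A i j * (z i * z j)

/-- The norm `√(A_ij zⁱ zʲ)`. -/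
def alp (A : Matrix (Fin n) (Fin n) ℝ) (z : Coord n) : ℝ := √(quad A z)

/-- The ratio `s = b_i zⁱ / α`. -/
def sv (A : Matrix (Fin n) (Fin n) ℝ) (b : Fin n → ℝ) (z : Coord n) : ℝ :=
  (∑ i, b i * z i) / alp A z

/-- The covector `l_j = A_ij zⁱ / α`. -/
def lv (A : Matrix (Fin n) (Fin n) ℝ) (z : Coord n) (j : Fin n) : ℝ :=
  (∑ i, A i j * z i) / alp A z

/-- The covector `m_j = b_j - s l_j`. -/
def mv (A : Matrix (Fin n) (Fin n) ℝ) (b : Fin n → ℝ) (z : Coord n) (j : Fin n) : ℝ :=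
  b j - sv A b z * lv A z j

/-- The angular tensor `h_jk = A_jk - l_j l_k`. -/
def hv (A : Matrix (Fin n) (Fin n) ℝ) (z : Coord n) (j k : Fin n) : ℝ :=
  A j k - lv A z j * lv A z k

/-- `A` is symmetric and positive definite. -/
structure IsMetric (A : Matrix (Fin n) (Fin n) ℝ) : Prop where
  symm : ∀ i j, A i j = A j i
  pos : ∀ z : Coord n, z ≠ 0 → 0 < quad A z

variable {A : Matrix (Fin n) (Fin n) ℝ} {b : Fin n → ℝ} {z : Coord n}

theorem IsMetric.alp_pos (hA : IsMetric A) (hz : z ≠ 0) : 0 < alp A z :=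
  Real.sqrt_pos.2 (hA.pos z hz)

theorem IsMetric.alp_sq (hA : IsMetric A) (hz : z ≠ 0) : alp A z ^ 2 = quad A z :=
  Real.sq_sqrt (hA.pos z hz).le

theorem hasPd_lin (c : Fin n → ℝ) (k : Fin n) (z : Coord n) :
    HasPd k (fun z => ∑ i, c i * z i) (c k) z := by
  refine (hasPd_sum Finset.univ fun i _ => (hasPd_coord k i z).const_mul (c i)).congr_val ?_
  simp

theorem hasPd_quad' (A : Matrix (Fin n) (Fin n) ℝ) (k : Fin n) (z : Coord n) :
    HasPd k (quad A) (∑ i, (A i k + A k i) * z i) z := by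
  refine (hasPd_sum Finset.univ fun i _ => hasPd_sum Finset.univ fun j _ =>
    ((hasPd_coord k i z).mul (hasPd_coord k j z)).const_mul (A i j)).congr_val ?_
  simp only [mul_add, Finset.sum_add_distrib, add_mul]
  simp [add_comm]

theorem hasPd_quad (hA : IsMetric A) (k : Fin n) (z : Coord n) :
    HasPd k (quad A) (2 * ∑ i, A i k * z i) z := by
  refine (hasPd_quad' A k z).congr_val ?_
  rw [Finset.mul_sum]
  refine Finset.sum_congr rfl fun i _ => ?_
  rw [hA.symm k i]; ring

theorem hasPd_alp (hA : IsMetric A) (hz : z ≠ 0) (k : Fin n) :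
    HasPd k (alp A) (lv A z k) z := by
  refine (HasPd.comp (Real.hasDerivAt_sqrt (hA.pos z hz).ne') (hasPd_quad hA k z)).congr_val ?_
  have := (hA.alp_pos hz).ne'
  rw [lv, ← alp]
  field_simp

theorem hasPd_lv (hA : IsMetric A) (hz : z ≠ 0) (j k : Fin n) :
    HasPd k (fun z => lv A z j) (hv A z j k / alp A z) z := by
  have h0 := (hA.alp_pos hz).ne'
  refine ((hasPd_lin (fun i => A i j) k z).div (hasPd_alp hA hz k) h0).congr_val ?_
  rw [hv, hA.symm j k, lv, lv]
  field_simp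

theorem hasPd_sv (hA : IsMetric A) (b : Fin n → ℝ) (hz : z ≠ 0) (k : Fin n) :
    HasPd k (sv A b) (mv A b z k / alp A z) z := by
  have h0 := (hA.alp_pos hz).ne'
  refine ((hasPd_lin b k z).div (hasPd_alp hA hz k) h0).congr_val ?_
  rw [mv, sv]
  field_simp

theorem hasPd_mv (hA : IsMetric A) (b : Fin n → ℝ) (hz : z ≠ 0) (j k : Fin n) :
    HasPd k (fun z => mv A b z j)
      (-(mv A b z k * lv A z j + sv A b z * hv A z j k) / alp A z) z := by
  refine ((hasPd_const k (b j) z).sub ((hasPd_sv hA b hz k).mul (hasPd_lv hA hz j k))).congr_val ?_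
  ring

theorem hasPd_hv (hA : IsMetric A) (hz : z ≠ 0) (i j k : Fin n) :
    HasPd k (fun z => hv A z i j)
      (-(hv A z i k * lv A z j + lv A z i * hv A z j k) / alp A z) z := by
  refine ((hasPd_const k (A i j) z).sub
    ((hasPd_lv hA hz i k).mul (hasPd_lv hA hz j k))).congr_val ?_
  ring

/-! ### Fibre derivatives of α f(s), α² f(s) and α³ f(s); f is differentiated only at values taken
by s, as φ need not be smooth elsewhere. -/

section Homogeneous

variable {f f1 f2 f3 : ℝ → ℝ}

theorem hasPd_alp_mul (hA : IsMetric A)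
    (hf : ∀ z : Coord n, z ≠ 0 → HasDerivAt f (f1 (sv A b z)) (sv A b z))
    (hz : z ≠ 0) (j : Fin n) :
    HasPd j (fun z => alp A z * f (sv A b z))
      (f (sv A b z) * lv A z j + f1 (sv A b z) * mv A b z j) z := by
  have h0 := (hA.alp_pos hz).ne'
  refine ((hasPd_alp hA hz j).mul (HasPd.comp (hf z hz) (hasPd_sv hA b hz j))).congr_val ?_
  field_simp

theorem hasPd_alp_mul₂ (hA : IsMetric A)
    (hf : ∀ z : Coord n, z ≠ 0 → HasDerivAt f (f1 (sv A b z)) (sv A b z))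
    (hf1 : ∀ z : Coord n, z ≠ 0 → HasDerivAt f1 (f2 (sv A b z)) (sv A b z))
    (hz : z ≠ 0) (j k : Fin n) :
    HasPd k (fun z => f (sv A b z) * lv A z j + f1 (sv A b z) * mv A b z j)
      (((f (sv A b z) - sv A b z * f1 (sv A b z)) * hv A z j k +
        f2 (sv A b z) * (mv A b z j * mv A b z k)) / alp A z) z := by
  have h0 := (hA.alp_pos hz).ne'
  refine (((HasPd.comp (hf z hz) (hasPd_sv hA b hz k)).mul (hasPd_lv hA hz j k)).add
    ((HasPd.comp (hf1 z hz) (hasPd_sv hA b hz k)).mul (hasPd_mv hA b hz j k))).congr_val ?_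
  field_simp
  ring

/-- The Hessian of the 1-homogeneous α f(s) is homogeneous of degree -1. By Euler's relation the
terms containing l are therefore minus the Hessian times l/α, symmetrized; they are what cancels
later in the Landsberg curvature. -/
theorem hasPd_alp_mul₃ (hA : IsMetric A)
    (hf : ∀ z : Coord n, z ≠ 0 → HasDerivAt f (f1 (sv A b z)) (sv A b z))
    (hf1 : ∀ z : Coord n, z ≠ 0 → HasDerivAt f1 (f2 (sv A b z)) (sv A b z))
    (hf2 : ∀ z : Coord n, z ≠ 0 → HasDerivAt f2 (f3 (sv A b z)) (sv A b z))
    (hz : z ≠ 0) (j k l : Fin n) :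
    HasPd l (fun z => ((f (sv A b z) - sv A b z * f1 (sv A b z)) * hv A z j k +
        f2 (sv A b z) * (mv A b z j * mv A b z k)) / alp A z)
      ((f3 (sv A b z) * (mv A b z j * mv A b z k * mv A b z l)
        - sv A b z * f2 (sv A b z) * (hv A z j k * mv A b z l + hv A z j l * mv A b z k
            + hv A z k l * mv A b z j)
        - (f (sv A b z) - sv A b z * f1 (sv A b z)) * (hv A z j k * lv A z l
            + hv A z j l * lv A z k + hv A z k l * lv A z j)
        - f2 (sv A b z) * (mv A b z j * mv A b z k * lv A z l + mv A b z j * mv A b z l * lv A z k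
            + mv A b z k * mv A b z l * lv A z j)) / alp A z ^ 2) z := by
  have h0 := (hA.alp_pos hz).ne'
  have hs := hasPd_sv hA b hz l
  refine (((((HasPd.comp (hf z hz) hs).sub (hs.mul (HasPd.comp (hf1 z hz) hs))).mul
    (hasPd_hv hA hz j k l)).add ((HasPd.comp (hf2 z hz) hs).mul
      ((hasPd_mv hA b hz j l).mul (hasPd_mv hA b hz k l)))).div
        (hasPd_alp hA hz l) h0).congr_val ?_
  field_simp
  ring

theorem hasPd_alp_sq_mul (hA : IsMetric A)
    (hf : ∀ z : Coord n, z ≠ 0 → HasDerivAt f (f1 (sv A b z)) (sv A b z))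
    (hz : z ≠ 0) (j : Fin n) :
    HasPd j (fun z => alp A z ^ 2 * f (sv A b z))
      (alp A z * (2 * f (sv A b z) * lv A z j + f1 (sv A b z) * mv A b z j)) z := by
  have h0 := (hA.alp_pos hz).ne'
  refine (HasPd.congr_fun ((hasPd_alp hA hz j).mul (hasPd_alp_mul hA hf hz j))
    (.of_forall fun w => by ring)).congr_val ?_
  ring

theorem hasPd_alp_sq_mul₂ (hA : IsMetric A)
    (hf : ∀ z : Coord n, z ≠ 0 → HasDerivAt f (f1 (sv A b z)) (sv A b z))
    (hf1 : ∀ z : Coord n, z ≠ 0 → HasDerivAt f1 (f2 (sv A b z)) (sv A b z))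
    (hz : z ≠ 0) (j k : Fin n) :
    HasPd k (fun z => alp A z * (2 * f (sv A b z) * lv A z j + f1 (sv A b z) * mv A b z j))
      (2 * f (sv A b z) * (lv A z j * lv A z k)
        + f1 (sv A b z) * (lv A z j * mv A b z k + mv A b z j * lv A z k)
        + (2 * f (sv A b z) - sv A b z * f1 (sv A b z)) * hv A z j k
        + f2 (sv A b z) * (mv A b z j * mv A b z k)) z := by
  have h0 := (hA.alp_pos hz).ne'
  have hs := hasPd_sv hA b hz k
  refine ((hasPd_alp hA hz k).mul
    ((((HasPd.comp (hf z hz) hs).const_mul 2).mul (hasPd_lv hA hz j k)).add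
    ((HasPd.comp (hf1 z hz) hs).mul (hasPd_mv hA b hz j k)))).congr_val ?_
  field_simp
  ring

/-- No l survives: the Hessian of a 2-homogeneous function has degree 0, so its derivative is
annihilated by y. -/
theorem hasPd_alp_sq_mul₃ (hA : IsMetric A)
    (hf : ∀ z : Coord n, z ≠ 0 → HasDerivAt f (f1 (sv A b z)) (sv A b z))
    (hf1 : ∀ z : Coord n, z ≠ 0 → HasDerivAt f1 (f2 (sv A b z)) (sv A b z))
    (hf2 : ∀ z : Coord n, z ≠ 0 → HasDerivAt f2 (f3 (sv A b z)) (sv A b z))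
    (hz : z ≠ 0) (j k l : Fin n) :
    HasPd l (fun z => 2 * f (sv A b z) * (lv A z j * lv A z k)
        + f1 (sv A b z) * (lv A z j * mv A b z k + mv A b z j * lv A z k)
        + (2 * f (sv A b z) - sv A b z * f1 (sv A b z)) * hv A z j k
        + f2 (sv A b z) * (mv A b z j * mv A b z k))
      (((f1 (sv A b z) - sv A b z * f2 (sv A b z)) * (hv A z j k * mv A b z l
          + hv A z j l * mv A b z k + hv A z k l * mv A b z j)
        + f3 (sv A b z) * (mv A b z j * mv A b z k * mv A b z l)) / alp A z) z := by
  have h0 := (hA.alp_pos hz).ne'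
  have hs := hasPd_sv hA b hz l
  have h := HasPd.comp (hf z hz) hs
  have h1 := HasPd.comp (hf1 z hz) hs
  have h2 := HasPd.comp (hf2 z hz) hs
  have lj := hasPd_lv hA hz j l
  have lk := hasPd_lv hA hz k l
  have mj := hasPd_mv hA b hz j l
  have mk := hasPd_mv hA b hz k l
  refine (((((h.const_mul 2).mul (lj.mul lk)).add (h1.mul ((lj.mul mk).add (mj.mul lk)))).add
    (((h.const_mul 2).sub (hs.mul h1)).mul (hasPd_hv hA hz j k l))).add
    (h2.mul (mj.mul mk))).congr_val ?_
  field_simp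
  ring

theorem hasPd_alp_cube_mul (hA : IsMetric A)
    (hf : ∀ z : Coord n, z ≠ 0 → HasDerivAt f (f1 (sv A b z)) (sv A b z))
    (hz : z ≠ 0) (j : Fin n) :
    HasPd j (fun z => alp A z ^ 3 * f (sv A b z))
      (alp A z ^ 2 * (3 * f (sv A b z) * lv A z j + f1 (sv A b z) * mv A b z j)) z := by
  refine (HasPd.congr_fun ((hasPd_alp hA hz j).mul (hasPd_alp_sq_mul hA hf hz j))
    (.of_forall fun w => by ring)).congr_val ?_
  ring

end Homogeneous

end Fibre

/-! ### Linear algebra of the fundamental tensor -/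

section Algebra

open Matrix

variable {n : ℕ}

/-- `l`, `m` are orthogonal covectors with `|l| = 1`, `|m|² = D` with respect to the inner product
`A` whose inverse is `B`, and `lU`, `mU` are the dual vectors. -/
structure IsFrame (A B : Matrix (Fin n) (Fin n) ℝ) (l m lU mU : Fin n → ℝ) (D : ℝ) : Prop where
  symm : Aᵀ = A
  mul_inv : A * B = 1
  l_eq : A *ᵥ lU = l
  m_eq : A *ᵥ mU = m
  l_l : l ⬝ᵥ lU = 1
  m_l : m ⬝ᵥ lU = 0
  m_m : m ⬝ᵥ mU = D

/-- The inverse of the fundamental tensor, up to the values of the coefficients. -/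
def invTensor (B : Matrix (Fin n) (Fin n) ℝ) (lU mU : Fin n → ℝ) (ρ η σ τ : ℝ) :
    Matrix (Fin n) (Fin n) ℝ :=
  ρ⁻¹ • (B + η • vecMulVec mU mU) + σ • (vecMulVec lU mU + vecMulVec mU lU) + τ • vecMulVec lU lU

namespace IsFrame

variable {A B : Matrix (Fin n) (Fin n) ℝ} {l m lU mU : Fin n → ℝ} {D : ℝ}

theorem inv_mul (h : IsFrame A B l m lU mU D) : B * A = 1 :=
  mul_eq_one_comm.1 h.mul_inv

theorem inv_symm (h : IsFrame A B l m lU mU D) : Bᵀ = B := by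
  have h1 : A * Bᵀ = 1 := by
    have := congrArg Matrix.transpose h.inv_mul
    rwa [transpose_mul, h.symm, transpose_one] at this
  calc Bᵀ = B * A * Bᵀ := by rw [h.inv_mul, one_mul]
    _ = B := by rw [mul_assoc, h1, mul_one]

theorem inv_l (h : IsFrame A B l m lU mU D) : B *ᵥ l = lU := by
  rw [← h.l_eq, mulVec_mulVec, h.inv_mul, one_mulVec]

theorem inv_m (h : IsFrame A B l m lU mU D) : B *ᵥ m = mU := by
  rw [← h.m_eq, mulVec_mulVec, h.inv_mul, one_mulVec]

theorem l_m (h : IsFrame A B l m lU mU D) : l ⬝ᵥ mU = 0 := by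
  rw [← h.inv_m, dotProduct_mulVec, ← mulVec_transpose, h.inv_symm, h.inv_l, dotProduct_comm, h.m_l]

/-- Orthogonally to l and m the tensor is f ψ times A. In the directions l and m/√D it is the block
with entries f², f f2 √D and f Δ + f2² D, of determinant f³Δ; inverting it gives the coefficients.
The summand -1/(f ψ) removes the l ⊗ l part already contained in B. The product is checked directly,
so D = 0 is allowed. -/
theorem fund_mul_invTensor (h : IsFrame A B l m lU mU D) {f f2 f22 ψ Δ : ℝ} (hf : f ≠ 0)
    (hψ : ψ ≠ 0) (hΔ : Δ ≠ 0) (e : Δ = ψ + D * f22) :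
    ((f * ψ) • (A - vecMulVec l l) + (f * f22) • vecMulVec m m +
      vecMulVec (f • l + f2 • m) (f • l + f2 • m)) *
      invTensor B lU mU (f * ψ) (-(f22 / Δ)) (-(f2 / (f ^ 2 * Δ)))
        (1 / f ^ 2 - 1 / (f * ψ) + f2 ^ 2 * D / (f ^ 3 * Δ)) = 1 := by
  have e1 (x : Fin n → ℝ) : vecMulVec x l * B = vecMulVec x lU := by
    rw [vecMulVec_mul, ← mulVec_transpose, h.inv_symm, h.inv_l]
  have e2 (x : Fin n → ℝ) : vecMulVec x m * B = vecMulVec x mU := by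
    rw [vecMulVec_mul, ← mulVec_transpose, h.inv_symm, h.inv_m]
  have e3 (x : Fin n → ℝ) : A * vecMulVec lU x = vecMulVec l x := by rw [mul_vecMulVec, h.l_eq]
  have e4 (x : Fin n → ℝ) : A * vecMulVec mU x = vecMulVec m x := by rw [mul_vecMulVec, h.m_eq]
  rw [invTensor]
  simp only [add_mul, mul_add, sub_mul, smul_mul_assoc, mul_smul_comm, add_vecMulVec, vecMulVec_add,
    smul_vecMulVec, vecMulVec_smul, vecMulVec_mul_vecMulVec, h.l_l, h.m_l, h.l_m, h.m_m, h.mul_inv,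
    e1, e2, e3, e4]
  ext i j
  simp only [Matrix.add_apply, Matrix.sub_apply, Matrix.smul_apply, vecMulVec_apply, smul_eq_mul]
  field_simp
  rw [e]
  ring

theorem ang_mulVec_m (h : IsFrame A B l m lU mU D) : (A - vecMulVec l l) *ᵥ mU = m := by
  rw [sub_mulVec, h.m_eq, vecMulVec_mulVec, h.l_m]; simp

theorem ang_mulVec_l (h : IsFrame A B l m lU mU D) : (A - vecMulVec l l) *ᵥ lU = 0 := by
  rw [sub_mulVec, h.l_eq, vecMulVec_mulVec, h.l_l]; simp

theorem invTensor_symm (h : IsFrame A B l m lU mU D) (ρ η σ τ : ℝ) (k l : Fin n) :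
    invTensor B lU mU ρ η σ τ k l = invTensor B lU mU ρ η σ τ l k := by
  have : B k l = B l k := congrFun (congrFun h.inv_symm l) k
  simp only [invTensor, Matrix.add_apply, Matrix.smul_apply, vecMulVec_apply, smul_eq_mul, this]
  ring

theorem invTensor_mulVec_m (h : IsFrame A B l m lU mU D) (ρ η σ τ : ℝ) :
    invTensor B lU mU ρ η σ τ *ᵥ m = (ρ⁻¹ * (1 + η * D)) • mU + (σ * D) • lU := by
  have h1 : mU ⬝ᵥ m = D := by rw [dotProduct_comm, h.m_m]
  have h2 : lU ⬝ᵥ m = 0 := by rw [dotProduct_comm, h.m_l]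
  simp only [invTensor, add_mulVec, smul_mulVec, h.inv_m, vecMulVec_mulVec, h1, h2]
  ext i
  simp
  ring

/-- The angular tensor kills `lU`, so `σ` and `τ` disappear. Against B it has trace n - 1, and
against mU ⊗ mU it gives |m|² = D. -/
theorem sum_invTensor_mul_ang (h : IsFrame A B l m lU mU D) (ρ η σ τ : ℝ) :
    ∑ i, ∑ j, invTensor B lU mU ρ η σ τ i j * (A - vecMulVec l l) i j
      = ρ⁻¹ * (n - 1 + η * D) := by
  have hs : (A - vecMulVec l l)ᵀ = A - vecMulVec l l := by
    rw [transpose_sub, h.symm, transpose_vecMulVec]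
  have h1 : ∑ i, ∑ j, invTensor B lU mU ρ η σ τ i j * (A - vecMulVec l l) i j
      = trace ((A - vecMulVec l l) * invTensor B lU mU ρ η σ τ) := by
    rw [trace_mul_comm, trace]
    refine Finset.sum_congr rfl fun i _ => ?_
    rw [diag_apply, mul_apply]
    refine Finset.sum_congr rfl fun j _ => ?_
    rw [← hs, transpose_apply, hs]
  have e1 : l ᵥ* B = lU := by rw [← mulVec_transpose, h.inv_symm, h.inv_l]
  rw [h1, invTensor]
  simp only [mul_add, mul_smul_comm, mul_vecMulVec, h.ang_mulVec_m, h.ang_mulVec_l]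
  simp only [sub_mul, h.mul_inv, vecMulVec_mul, e1, trace_add, trace_sub, trace_smul,
    trace_vecMulVec, h.l_l, h.m_l, h.m_m, trace_one]
  simp
  ring

/-- Contraction of a symmetric tensor of the form of the Landsberg curvature. -/
theorem contract (h : IsFrame A B l m lU mU D) (ρ η σ τ X Z : ℝ) (j : Fin n) :
    ∑ k, ∑ i, invTensor B lU mU ρ η σ τ k i *
      (X * ((A - vecMulVec l l) j k * m i + (A - vecMulVec l l) j i * m k +
        (A - vecMulVec l l) k i * m j) + Z * (m j * m k * m i)) =
      ρ⁻¹ * (X * (n + 1 + 3 * η * D) + Z * (D + η * D ^ 2)) * m j := by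
  set N := invTensor B lU mU ρ η σ τ with hN
  set a := A - vecMulVec l l with ha
  -- N m is a multiple of `mU` plus a multiple of `lU`; the angular tensor sends `mU` to m and `lU`
  -- to 0.
  have h1 : ∑ k, ∑ i, N k i * (a j k * m i) = ρ⁻¹ * (1 + η * D) * m j := by
    calc ∑ k, ∑ i, N k i * (a j k * m i) = (a *ᵥ (N *ᵥ m)) j := by
          simp only [mulVec, dotProduct, Finset.mul_sum]
          exact Finset.sum_congr rfl fun k _ => Finset.sum_congr rfl fun i _ => by ring
      _ = _ := by
          rw [hN, h.invTensor_mulVec_m, mulVec_add, mulVec_smul, mulVec_smul, h.ang_mulVec_m,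
            h.ang_mulVec_l]
          simp
  have h2 : ∑ k, ∑ i, N k i * (a j i * m k) = ρ⁻¹ * (1 + η * D) * m j := by
    rw [Finset.sum_comm, ← h1]
    refine Finset.sum_congr rfl fun k _ => Finset.sum_congr rfl fun i _ => ?_
    rw [hN, h.invTensor_symm]
  have h3 : ∑ k, ∑ i, N k i * (m k * m i) = ρ⁻¹ * (1 + η * D) * D := by
    calc ∑ k, ∑ i, N k i * (m k * m i) = m ⬝ᵥ (N *ᵥ m) := by
          simp only [mulVec, dotProduct, Finset.mul_sum]
          exact Finset.sum_congr rfl fun k _ => Finset.sum_congr rfl fun i _ => by ring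
      _ = _ := by
          rw [hN, h.invTensor_mulVec_m, dotProduct_add, dotProduct_smul, dotProduct_smul, h.m_m,
            h.m_l]
          simp
  have h4 := h.sum_invTensor_mul_ang ρ η σ τ
  rw [← hN, ← ha] at h4
  have : ∀ k i, N k i * (X * (a j k * m i + a j i * m k + a k i * m j) + Z * (m j * m k * m i)) =
      X * (N k i * (a j k * m i)) + X * (N k i * (a j i * m k)) + (X * m j) * (N k i * a k i)
        + (Z * m j) * (N k i * (m k * m i)) := fun k i => by ring
  simp only [this, Finset.sum_add_distrib, ← Finset.mul_sum, h1, h2, h3, h4]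
  ring

end IsFrame

end Algebra

/-! ### The function `φ` and the scalars built from it -/

section Scalars

/-- Smoothness of a function of two real variables at a point. -/
def SmoothAt (f : ℝ → ℝ → ℝ) (t s : ℝ) : Prop :=
  ContDiffAt ℝ ∞ (fun p : ℝ × ℝ => f p.1 p.2) (t, s)

namespace SmoothAt

variable {f g : ℝ → ℝ → ℝ} {t s : ℝ}

theorem differentiableAt (h : SmoothAt f t s) :
    DifferentiableAt ℝ (fun p : ℝ × ℝ => f p.1 p.2) (t, s) :=
  ContDiffAt.differentiableAt h (by simp)

theorem eventually_differentiableAt (h : SmoothAt f t s) :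
    ∀ᶠ p in nhds (t, s), DifferentiableAt ℝ (fun p : ℝ × ℝ => f p.1 p.2) p := by
  have h1 : ContDiffAt ℝ 1 (fun p : ℝ × ℝ => f p.1 p.2) (t, s) := h.of_le (by simp)
  filter_upwards [h1.eventually (by simp)] with p hp using hp.differentiableAt (by simp)

theorem _root_.GenAB.hasDerivAt_snd {t s : ℝ}
    (h : DifferentiableAt ℝ (fun p : ℝ × ℝ => f p.1 p.2) (t, s)) :
    HasDerivAt (fun r => f t r) (fderiv ℝ (fun p : ℝ × ℝ => f p.1 p.2) (t, s) (0, 1)) s := by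
  have : HasDerivAt (fun r : ℝ => (t, r)) ((0 : ℝ), (1 : ℝ)) s :=
    (hasDerivAt_const _ _).prodMk (hasDerivAt_id _)
  exact h.hasFDerivAt.comp_hasDerivAt s this

theorem _root_.GenAB.hasDerivAt_fst {t s : ℝ}
    (h : DifferentiableAt ℝ (fun p : ℝ × ℝ => f p.1 p.2) (t, s)) :
    HasDerivAt (fun r => f r s) (fderiv ℝ (fun p : ℝ × ℝ => f p.1 p.2) (t, s) (1, 0)) t := by
  have : HasDerivAt (fun r : ℝ => (r, s)) ((1 : ℝ), (0 : ℝ)) t :=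
    (hasDerivAt_id _).prodMk (hasDerivAt_const _ _)
  exact h.hasFDerivAt.comp_hasDerivAt t this

theorem hasDerivAt (h : SmoothAt f t s) : HasDerivAt (fun r => f t r) (d2 f t s) s :=
  (hasDerivAt_snd h.differentiableAt).differentiableAt.hasDerivAt

theorem fderiv (h : SmoothAt f t s) (v : ℝ × ℝ) :
    ContDiffAt ℝ ∞ (fun p => fderiv ℝ (fun p : ℝ × ℝ => f p.1 p.2) p v) (t, s) :=
  (ContDiffAt.fderiv_right h (m := ∞) (by simp)).clm_apply contDiffAt_const

/-- Near the point `d2 f` agrees with the Fréchet derivative in direction (0, 1). Smoothness at a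
point thus passes to partial derivatives and can be iterated. -/
theorem d2 (h : SmoothAt f t s) : SmoothAt (d2 f) t s := by
  refine (h.fderiv (0, 1)).congr_of_eventuallyEq ?_
  filter_upwards [h.eventually_differentiableAt] with p hp using (hasDerivAt_snd hp).deriv

theorem d1 (h : SmoothAt f t s) : SmoothAt (d1 f) t s := by
  refine (h.fderiv (1, 0)).congr_of_eventuallyEq ?_
  filter_upwards [h.eventually_differentiableAt] with p hp using (hasDerivAt_fst hp).deriv

theorem delta (h : SmoothAt f t s) :
    SmoothAt (fun t s => f t s - s * GenAB.d2 f t s + (t - s ^ 2) * GenAB.d2 (GenAB.d2 f) t s)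
      t s := by
  have h2 := h.d2
  have h22 := h2.d2
  unfold SmoothAt at *
  exact (h.sub (contDiffAt_snd.mul h2)).add ((contDiffAt_fst.sub (contDiffAt_snd.pow 2)).mul h22)

theorem hfun (h : SmoothAt f t s)
    (h0 : f t s - s * GenAB.d2 f t s + (t - s ^ 2) * GenAB.d2 (GenAB.d2 f) t s ≠ 0) :
    SmoothAt (Hfun f) t s := by
  have hΔ := h.delta
  have h1 := h.d1
  have h12 := h1.d2
  have h22 := h.d2.d2
  unfold SmoothAt at *
  exact (h22.sub (contDiffAt_const.mul (h1.sub (contDiffAt_snd.mul h12)))).div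
    (contDiffAt_const.mul hΔ) (mul_ne_zero two_ne_zero h0)

theorem efun (h : SmoothAt f t s) (hf : f t s ≠ 0)
    (h0 : f t s - s * GenAB.d2 f t s + (t - s ^ 2) * GenAB.d2 (GenAB.d2 f) t s ≠ 0) :
    SmoothAt (Efun f) t s := by
  have hH := h.hfun h0
  have h1 := h.d1
  have h2 := h.d2
  unfold SmoothAt at *
  exact ((h2.add ((contDiffAt_const.mul contDiffAt_snd).mul h1)).div
    (contDiffAt_const.mul h) (mul_ne_zero two_ne_zero hf)).sub
    (hH.mul (((contDiffAt_snd.mul h).add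
      ((contDiffAt_fst.sub (contDiffAt_snd.pow 2)).mul h2)).div h hf))

end SmoothAt

/-- The function (f - y f') √(b² - y²) has derivative -y (f - y f' + (b² - y²) f'') / √(b² - y²),
which is negative on (x, b). It vanishes at b, so it is positive at x. -/
theorem sub_mul_deriv_pos_of_pos {f f1 f2 : ℝ → ℝ} {b x : ℝ} (hx : 0 < x) (hxb : x < b)
    (hf : ∀ y, |y| ≤ b → HasDerivAt f (f1 y) y) (hf1 : ∀ y, |y| ≤ b → HasDerivAt f1 (f2 y) y)
    (h : ∀ y, |y| ≤ b → 0 < f y - y * f1 y + (b ^ 2 - y ^ 2) * f2 y) :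
    0 < f x - x * f1 x := by
  have habs : ∀ y ∈ Set.Icc x b, |y| ≤ b := fun y hy => by
    rw [abs_of_pos (hx.trans_le hy.1)]; exact hy.2
  set g : ℝ → ℝ := fun y => (f y - y * f1 y) * √(b ^ 2 - y ^ 2) with hg
  have hanti : StrictAntiOn g (Set.Icc x b) := by
    refine strictAntiOn_of_deriv_neg (convex_Icc x b) ?_ ?_
    · intro y hy
      refine ContinuousAt.continuousWithinAt ?_
      have h1 := (hf y (habs y hy)).continuousAt
      have h2 := (hf1 y (habs y hy)).continuousAt
      exact (h1.sub (continuousAt_id.mul h2)).mul (by fun_prop)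
    · intro y hy
      rw [interior_Icc] at hy
      have hy' := habs y ⟨hy.1.le, hy.2.le⟩
      have hpos : 0 < b ^ 2 - y ^ 2 := by nlinarith [hy.1, hy.2]
      have hsq : HasDerivAt (fun y => √(b ^ 2 - y ^ 2)) (-(2 * y) / (2 * √(b ^ 2 - y ^ 2))) y := by
        have := ((hasDerivAt_pow 2 y).const_sub (b ^ 2)).sqrt hpos.ne'
        convert this using 1
        simp
      have hd := ((hf y hy').sub ((hasDerivAt_id y).mul (hf1 y hy'))).mul hsq
      have hr : 0 < √(b ^ 2 - y ^ 2) := Real.sqrt_pos.2 hpos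
      have hval : deriv g y = -(y * (f y - y * f1 y + (b ^ 2 - y ^ 2) * f2 y)) / √(b ^ 2 - y ^ 2) := by
        refine hd.deriv.trans ?_
        have e : √(b ^ 2 - y ^ 2) * √(b ^ 2 - y ^ 2) = b ^ 2 - y ^ 2 := Real.mul_self_sqrt hpos.le
        generalize √(b ^ 2 - y ^ 2) = r at e hr
        simp only [Pi.sub_apply, Pi.mul_apply, id]
        rw [← e]
        field_simp
        ring
      rw [hval]
      exact div_neg_of_neg_of_pos (neg_neg_of_pos (mul_pos (hx.trans hy.1) (h y hy'))) hr
  have := hanti (Set.left_mem_Icc.2 hxb.le) (Set.right_mem_Icc.2 hxb.le) hxb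
  simp only [hg, sub_self, Real.sqrt_zero, mul_zero] at this
  exact pos_of_mul_pos_left this (Real.sqrt_nonneg _)

theorem sub_mul_deriv_pos {f f1 f2 : ℝ → ℝ} {b x : ℝ} (hx : |x| ≤ b)
    (hf : ∀ y, |y| ≤ b → HasDerivAt f (f1 y) y) (hf1 : ∀ y, |y| ≤ b → HasDerivAt f1 (f2 y) y)
    (hpos : 0 < f 0) (h : ∀ y, |y| ≤ b → 0 < f y - y * f1 y + (b ^ 2 - y ^ 2) * f2 y) :
    0 < f x - x * f1 x := by
  rcases hx.eq_or_lt with hxb | hxb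
  -- At |x| = b the second-derivative term vanishes and the hypothesis is the claim.
  · have := h x hx
    rwa [← hxb, sq_abs, sub_self, zero_mul, add_zero] at this
  rcases lt_trichotomy x 0 with h0 | rfl | h0
  -- Reflection y ↦ -y preserves both f - y f' and the hypothesis, so the positive case applies.
  · have hd {k k' : ℝ → ℝ} (hk : ∀ y, |y| ≤ b → HasDerivAt k (k' y) y) (y : ℝ) (hy : |y| ≤ b) :
        HasDerivAt (fun y => k (-y)) (-k' (-y)) y := by
      have := (hk (-y) (by rwa [abs_neg])).comp y (hasDerivAt_neg y)
      simpa [Function.comp_def] using this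
    have := sub_mul_deriv_pos_of_pos (f := fun y => f (-y)) (f1 := fun y => -f1 (-y))
      (f2 := fun y => f2 (-y)) (b := b) (x := -x) (by linarith) (by rwa [abs_of_neg h0] at hxb)
      (hd hf) (fun y hy => (hd hf1 y hy).neg.congr_deriv (neg_neg _)) (fun y hy => by
        have := h (-y) (by rwa [abs_neg])
        simpa using this)
    simpa using this
  · simpa using hpos
  · exact sub_mul_deriv_pos_of_pos h0 (by rwa [abs_of_pos h0] at hxb) hf hf1 h

variable {n : ℕ} {b₀ : EReal} {φ : ℝ → ℝ → ℝ} {t s : ℝ}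

theorem IsAdmissible.smoothAt (hφ : IsAdmissible n b₀ φ) (h : (t, s) ∈ region b₀) :
    SmoothAt φ t s := by
  obtain ⟨U, hU, hsub, hc⟩ := hφ.smooth
  exact hc.contDiffAt (hU.mem_nhds (hsub h))

theorem IsAdmissible.sub_mul_pos (hφ : IsAdmissible n b₀ φ) (h : (t, s) ∈ region b₀) :
    0 < φ t s - s * d2 φ t s := by
  have hr : ∀ y, |y| ≤ √t → (t, y) ∈ region b₀ := fun y hy => ⟨h.1, hy, h.2.2⟩
  refine sub_mul_deriv_pos (f := fun r => φ t r) (f1 := fun r => d2 φ t r)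
    (f2 := fun r => d2 (d2 φ) t r) (b := √t) h.2.1
    (fun y hy => (hφ.smoothAt (hr y hy)).hasDerivAt)
    (fun y hy => (hφ.smoothAt (hr y hy)).d2.hasDerivAt)
    (hφ.pos _ _ (hr 0 (by simp))) fun y hy => ?_
  rw [Real.sq_sqrt h.1]
  exact hφ.convex₂ _ _ (hr y hy)

end Scalars

/-! ### The fundamental tensor of a general `(α, β)`-metric -/

section Fundamental

open Matrix

variable {n : ℕ} {A : Matrix (Fin n) (Fin n) ℝ} {b : Fin n → ℝ} {z : Coord n}

theorem quad_eq (A : Matrix (Fin n) (Fin n) ℝ) (z : Coord n) : quad A z = z.ofLp ⬝ᵥ A *ᵥ z.ofLp := by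
  simp only [quad, dotProduct, mulVec, Finset.mul_sum]
  exact Finset.sum_congr rfl fun i _ => Finset.sum_congr rfl fun j _ => by ring

theorem IsMetric.transpose_eq (hA : IsMetric A) : Aᵀ = A := by
  ext i j
  exact hA.symm j i

theorem IsMetric.isUnit_det (hA : IsMetric A) : IsUnit A.det := by
  rw [isUnit_iff_ne_zero]
  intro h
  obtain ⟨v, hv, h0⟩ := exists_mulVec_eq_zero_iff.2 h
  have := hA.pos (WithLp.toLp 2 v) (by simpa using hv)
  rw [quad_eq] at this
  simp [h0] at this

theorem IsMetric.quad_nonneg (hA : IsMetric A) (z : Coord n) : 0 ≤ quad A z := by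
  rcases eq_or_ne z 0 with rfl | hz
  · simp [quad]
  · exact (hA.pos z hz).le

/-- The squared norm of the covector `b`. -/
def nsq (A : Matrix (Fin n) (Fin n) ℝ) (b : Fin n → ℝ) : ℝ := b ⬝ᵥ A⁻¹ *ᵥ b

/-- The unit vector in direction `z`. -/
def lUp (A : Matrix (Fin n) (Fin n) ℝ) (z : Coord n) : Fin n → ℝ := (alp A z)⁻¹ • z.ofLp

/-- The vector dual to `mv`. -/
def mUp (A : Matrix (Fin n) (Fin n) ℝ) (b : Fin n → ℝ) (z : Coord n) : Fin n → ℝ :=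
  A⁻¹ *ᵥ b - sv A b z • lUp A z

theorem lv_eq (hA : IsMetric A) (z : Coord n) : lv A z = A *ᵥ lUp A z := by
  ext j
  simp only [lv, lUp, Pi.smul_apply, smul_eq_mul, mulVec, dotProduct, div_eq_inv_mul,
    Finset.mul_sum]
  exact Finset.sum_congr rfl fun i _ => by rw [hA.symm i j]; ring

theorem mv_eq (A : Matrix (Fin n) (Fin n) ℝ) (b : Fin n → ℝ) (z : Coord n) :
    mv A b z = b - sv A b z • lv A z := rfl

theorem dotProduct_lUp (A : Matrix (Fin n) (Fin n) ℝ) (b : Fin n → ℝ) (z : Coord n) :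
    b ⬝ᵥ lUp A z = sv A b z := by
  rw [lUp, dotProduct_smul, sv, smul_eq_mul, div_eq_inv_mul]; rfl

theorem isFrame (hA : IsMetric A) (b : Fin n → ℝ) (hz : z ≠ 0) :
    IsFrame A A⁻¹ (lv A z) (mv A b z) (lUp A z) (mUp A b z) (nsq A b - sv A b z ^ 2) := by
  have h0 := (hA.alp_pos hz).ne'
  have hd := hA.isUnit_det
  have hll : lv A z ⬝ᵥ lUp A z = 1 := by
    rw [lv_eq hA, dotProduct_comm, lUp, mulVec_smul, smul_dotProduct, dotProduct_smul, ← quad_eq,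
      ← hA.alp_sq hz]
    simp only [smul_eq_mul]
    field_simp
  have hlw : lv A z ⬝ᵥ A⁻¹ *ᵥ b = sv A b z := by
    rw [← dotProduct_lUp, lv_eq hA, dotProduct_comm, dotProduct_mulVec, ← mulVec_transpose,
      hA.transpose_eq, mulVec_mulVec, mul_nonsing_inv _ hd, one_mulVec]
  refine ⟨hA.transpose_eq, mul_nonsing_inv _ hd, (lv_eq hA z).symm, ?_, hll, ?_, ?_⟩
  · rw [mUp, mulVec_sub, mulVec_smul, ← lv_eq hA, mulVec_mulVec, mul_nonsing_inv _ hd, one_mulVec,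
      mv_eq]
  · rw [mv_eq, sub_dotProduct, smul_dotProduct, hll, dotProduct_lUp]
    simp
  · rw [mv_eq, mUp, sub_dotProduct, dotProduct_sub, dotProduct_sub, smul_dotProduct,
      smul_dotProduct, dotProduct_smul, dotProduct_smul, hll, hlw, dotProduct_lUp, nsq]
    simp only [smul_eq_mul]
    ring

/-- Cauchy–Schwarz: the difference b² - s² is the squared norm of `mUp`. -/
theorem sv_sq_le (hA : IsMetric A) (b : Fin n → ℝ) (hz : z ≠ 0) : sv A b z ^ 2 ≤ nsq A b := by
  have h := isFrame hA b hz
  have h1 := hA.quad_nonneg (WithLp.toLp 2 (mUp A b z))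
  rw [quad_eq, h.m_eq, dotProduct_comm, h.m_m] at h1
  linarith

theorem nsq_nonneg (hA : IsMetric A) (b : Fin n → ℝ) : 0 ≤ nsq A b := by
  have h1 := hA.quad_nonneg (WithLp.toLp 2 (A⁻¹ *ᵥ b))
  rwa [quad_eq, mulVec_mulVec, mul_nonsing_inv _ hA.isUnit_det, one_mulVec, dotProduct_comm] at h1

theorem mem_region (hA : IsMetric A) {b₀ : EReal} (hb : ((√(nsq A b) : ℝ) : EReal) < b₀)
    (hz : z ≠ 0) : (nsq A b, sv A b z) ∈ region b₀ :=
  ⟨nsq_nonneg hA b, Real.abs_le_sqrt (sv_sq_le hA b hz), hb⟩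

/-- The local expression of a general `(α, β)`-metric. -/
def localF (A : Coord n → Matrix (Fin n) (Fin n) ℝ) (b : Coord n → Fin n → ℝ) (φ : ℝ → ℝ → ℝ)
    (v z : Coord n) : ℝ :=
  alp (A v) z * φ (nsq (A v) (b v)) (sv (A v) (b v) z)

/-- The covector `∂F/∂y`. -/
def dualv (A : Matrix (Fin n) (Fin n) ℝ) (b : Fin n → ℝ) (φ : ℝ → ℝ → ℝ) (z : Coord n) :
    Fin n → ℝ :=
  φ (nsq A b) (sv A b z) • lv A z + d2 φ (nsq A b) (sv A b z) • mv A b z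

/-- The explicit form of the fundamental tensor. -/
def fundMat (A : Matrix (Fin n) (Fin n) ℝ) (b : Fin n → ℝ) (φ : ℝ → ℝ → ℝ) (z : Coord n) :
    Matrix (Fin n) (Fin n) ℝ :=
  rho φ (nsq A b) (sv A b z) • (A - vecMulVec (lv A z) (lv A z)) +
    (φ (nsq A b) (sv A b z) * d2 (d2 φ) (nsq A b) (sv A b z)) • vecMulVec (mv A b z) (mv A b z) +
    vecMulVec (dualv A b φ z) (dualv A b φ z)

section Fixed

variable {A : Coord n → Matrix (Fin n) (Fin n) ℝ} {b : Coord n → Fin n → ℝ} {φ : ℝ → ℝ → ℝ}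
  {u : Coord n}

theorem hasPd_localF_sq (hA : IsMetric (A u))
    (hφ : ∀ z : Coord n, z ≠ 0 → SmoothAt φ (nsq (A u) (b u)) (sv (A u) (b u) z))
    (hz : z ≠ 0) (k : Fin n) :
    HasPd k (fun z => localF A b φ u z ^ 2)
      (2 * (alp (A u) z * φ (nsq (A u) (b u)) (sv (A u) (b u) z) * dualv (A u) (b u) φ z k)) z := by
  have h := hasPd_alp_sq_mul (b := b u) hA (f := fun r => φ (nsq (A u) (b u)) r ^ 2)
    (f1 := fun r => 2 * φ (nsq (A u) (b u)) r * d2 φ (nsq (A u) (b u)) r)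
    (fun z hz => ((hφ z hz).hasDerivAt.fun_pow 2).congr_deriv (by simp)) hz k
  refine (h.congr_fun (.of_forall fun w => by simp only [localF]; ring)).congr_val ?_
  simp only [dualv, Pi.add_apply, Pi.smul_apply, smul_eq_mul]
  ring

theorem hasPd_pd_localF_sq (hA : IsMetric (A u))
    (hφ : ∀ z : Coord n, z ≠ 0 → SmoothAt φ (nsq (A u) (b u)) (sv (A u) (b u) z))
    (hz : z ≠ 0) (k l : Fin n) :
    HasPd l (pd k fun z => localF A b φ u z ^ 2) (2 * fundMat (A u) (b u) φ z k l) z := by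
  have h := hasPd_alp_sq_mul₂ (b := b u) hA (f := fun r => φ (nsq (A u) (b u)) r ^ 2)
    (f1 := fun r => 2 * φ (nsq (A u) (b u)) r * d2 φ (nsq (A u) (b u)) r)
    (f2 := fun r => 2 * d2 φ (nsq (A u) (b u)) r ^ 2 +
      2 * φ (nsq (A u) (b u)) r * d2 (d2 φ) (nsq (A u) (b u)) r)
    (fun z hz => ((hφ z hz).hasDerivAt.fun_pow 2).congr_deriv (by simp))
    (fun z hz => (((hφ z hz).hasDerivAt.const_mul 2).fun_mul (hφ z hz).d2.hasDerivAt).congr_deriv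
      (by ring)) hz k l
  refine (h.congr_ne (fun w hw => ?_) hz).congr_val ?_
  · rw [(hasPd_localF_sq hA hφ hw k).2]
    simp only [dualv, Pi.add_apply, Pi.smul_apply, smul_eq_mul]
    ring
  · simp only [fundMat, rho, hv, dualv, Matrix.add_apply, Matrix.smul_apply, vecMulVec_apply,
      Matrix.sub_apply, smul_eq_mul, Pi.add_apply, Pi.smul_apply]
    ring

theorem fundTensor_localF (hA : IsMetric (A u))
    (hφ : ∀ z : Coord n, z ≠ 0 → SmoothAt φ (nsq (A u) (b u)) (sv (A u) (b u) z))
    (hz : z ≠ 0) : fundTensor (localF A b φ) u z = fundMat (A u) (b u) φ z := by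
  ext k l
  rw [fundTensor, of_apply, (hasPd_pd_localF_sq hA hφ hz k l).2]
  ring

end Fixed

variable {φ : ℝ → ℝ → ℝ}

theorem fundMat_transpose (hA : IsMetric A) (b : Fin n → ℝ) (φ : ℝ → ℝ → ℝ) (z : Coord n) :
    (fundMat A b φ z)ᵀ = fundMat A b φ z := by
  simp only [fundMat, transpose_add, transpose_smul, transpose_sub, transpose_vecMulVec,
    hA.transpose_eq]

theorem dualv_dotProduct_lUp (hA : IsMetric A) (b : Fin n → ℝ) (φ : ℝ → ℝ → ℝ) (hz : z ≠ 0) :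
    dualv A b φ z ⬝ᵥ lUp A z = φ (nsq A b) (sv A b z) := by
  have h := isFrame hA b hz
  rw [dualv, add_dotProduct, smul_dotProduct, smul_dotProduct, h.l_l, h.m_l]
  simp

theorem dualv_dotProduct_mUp (hA : IsMetric A) (b : Fin n → ℝ) (φ : ℝ → ℝ → ℝ) (hz : z ≠ 0) :
    dualv A b φ z ⬝ᵥ mUp A b z = (nsq A b - sv A b z ^ 2) * d2 φ (nsq A b) (sv A b z) := by
  have h := isFrame hA b hz
  rw [dualv, add_dotProduct, smul_dotProduct, smul_dotProduct, h.l_m, h.m_m]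
  simp [mul_comm]

theorem fundMat_mulVec_lUp (hA : IsMetric A) (b : Fin n → ℝ) (φ : ℝ → ℝ → ℝ) (hz : z ≠ 0) :
    fundMat A b φ z *ᵥ lUp A z = φ (nsq A b) (sv A b z) • dualv A b φ z := by
  have h := isFrame hA b hz
  rw [fundMat, add_mulVec, add_mulVec, smul_mulVec, smul_mulVec, h.ang_mulVec_l, vecMulVec_mulVec,
    vecMulVec_mulVec, h.m_l, dualv_dotProduct_lUp hA b φ hz]
  simp

theorem fundMat_mulVec_mUp (hA : IsMetric A) (b : Fin n → ℝ) (φ : ℝ → ℝ → ℝ) (hz : z ≠ 0) :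
    fundMat A b φ z *ᵥ mUp A b z =
      (φ (nsq A b) (sv A b z) * (φ (nsq A b) (sv A b z) - sv A b z * d2 φ (nsq A b) (sv A b z) +
        (nsq A b - sv A b z ^ 2) * d2 (d2 φ) (nsq A b) (sv A b z))) • mv A b z +
      ((nsq A b - sv A b z ^ 2) * d2 φ (nsq A b) (sv A b z)) • dualv A b φ z := by
  have h := isFrame hA b hz
  rw [fundMat, add_mulVec, add_mulVec, smul_mulVec, smul_mulVec, h.ang_mulVec_m, vecMulVec_mulVec,
    vecMulVec_mulVec, h.m_m, dualv_dotProduct_mUp hA b φ hz, rho]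
  ext i
  simp
  ring

theorem fundMat_mul_invTensor (hA : IsMetric A) {b₀ : EReal} (hφ : IsAdmissible n b₀ φ)
    (hr : (nsq A b, sv A b z) ∈ region b₀) (hz : z ≠ 0) :
    ∃ σ τ, fundMat A b φ z * invTensor A⁻¹ (lUp A z) (mUp A b z)
      (rho φ (nsq A b) (sv A b z)) (eta φ (nsq A b) (sv A b z)) σ τ = 1 :=
  ⟨_, _, (isFrame hA b hz).fund_mul_invTensor (hφ.pos _ _ hr).ne' (hφ.sub_mul_pos hr).ne'
    (hφ.convex₂ _ _ hr).ne' rfl⟩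

end Fundamental

/-! ### Derivatives in the base variable -/

section Base

open Matrix

variable {n : ℕ}

/-- Local data of a metric `A` and a one-form `b` near `u` with `b_{i|j} = c a_ij` at `u`. -/
structure IsConformalAt (A : Coord n → Matrix (Fin n) (Fin n) ℝ) (b : Coord n → Fin n → ℝ)
    (c : ℝ) (u : Coord n) : Prop where
  symm : ∀ v i j, A v i j = A v j i
  pos : ∀ z : Coord n, z ≠ 0 → 0 < quad (A u) z
  smooth_A : ∀ i j, ContDiffAt ℝ ∞ (fun v => A v i j) u
  smooth_b : ∀ i, ContDiffAt ℝ ∞ (fun v => b v i) u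
  conf : ∀ i j, covDeriv A b u i j = c * A u i j

theorem contDiffAt_det {E : Type*} [NormedAddCommGroup E] [NormedSpace ℝ E]
    {M : E → Matrix (Fin n) (Fin n) ℝ} {x : E} {N : WithTop ℕ∞}
    (h : ∀ i j, ContDiffAt ℝ N (fun v => M v i j) x) : ContDiffAt ℝ N (fun v => (M v).det) x := by
  simp only [det_apply]
  exact ContDiffAt.sum fun σ _ => (contDiffAt_prod fun i _ => h _ _).const_smul _

theorem contDiffAt_inv {E : Type*} [NormedAddCommGroup E] [NormedSpace ℝ E]
    {M : E → Matrix (Fin n) (Fin n) ℝ} {x : E} {N : WithTop ℕ∞}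
    (h : ∀ i j, ContDiffAt ℝ N (fun v => M v i j) x) (hx : IsUnit (M x).det) (i j : Fin n) :
    ContDiffAt ℝ N (fun v => (M v)⁻¹ i j) x := by
  simp only [inv_def, Matrix.smul_apply, smul_eq_mul, Ring.inverse_eq_inv', adjugate_apply]
  refine ((contDiffAt_det h).inv hx.ne_zero).mul (contDiffAt_det fun k l => ?_)
  rcases eq_or_ne k j with rfl | hk
  · simpa using contDiffAt_const
  · simpa [updateRow_ne hk] using h k l

variable {A : Coord n → Matrix (Fin n) (Fin n) ℝ} {b : Coord n → Fin n → ℝ} {c : ℝ} {u : Coord n}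

namespace IsConformalAt

theorem isMetric (h : IsConformalAt A b c u) : IsMetric (A u) := ⟨h.symm u, h.pos⟩

theorem contDiffAt_nsq (h : IsConformalAt A b c u) :
    ContDiffAt ℝ ∞ (fun v => nsq (A v) (b v)) u := by
  simp only [nsq, dotProduct, mulVec]
  exact ContDiffAt.sum fun i _ => (h.smooth_b i).mul <| ContDiffAt.sum fun j _ =>
    (contDiffAt_inv h.smooth_A h.isMetric.isUnit_det i j).mul (h.smooth_b j)

theorem contDiffAt_localF_sq (h : IsConformalAt A b c u) {φ : ℝ → ℝ → ℝ} {y : Coord n} (hy : y ≠ 0)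
    (hφ : SmoothAt φ (nsq (A u) (b u)) (sv (A u) (b u) y)) :
    ContDiffAt ℝ ∞ (fun p : Coord n × Coord n => localF A b φ p.1 p.2 ^ 2) (u, y) := by
  have hc (i : Fin n) : ContDiffAt ℝ ∞ (fun p : Coord n × Coord n => p.2 i) (u, y) :=
    ((EuclideanSpace.proj i : Coord n →L[ℝ] ℝ).contDiff.comp contDiff_snd).contDiffAt
  have hA (i j : Fin n) : ContDiffAt ℝ ∞ (fun p : Coord n × Coord n => A p.1 i j) (u, y) :=
    ContDiffAt.comp (u, y) (h.smooth_A i j) contDiffAt_fst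
  have hb (i : Fin n) : ContDiffAt ℝ ∞ (fun p : Coord n × Coord n => b p.1 i) (u, y) :=
    ContDiffAt.comp (u, y) (h.smooth_b i) contDiffAt_fst
  have hT : ContDiffAt ℝ ∞ (fun p : Coord n × Coord n => nsq (A p.1) (b p.1)) (u, y) :=
    ContDiffAt.comp (g := fun v => nsq (A v) (b v)) (u, y) h.contDiffAt_nsq contDiffAt_fst
  have hq : ContDiffAt ℝ ∞ (fun p : Coord n × Coord n => alp (A p.1) p.2) (u, y) := by
    refine ContDiffAt.sqrt ?_ (h.pos y hy).ne'
    exact ContDiffAt.sum fun i _ => ContDiffAt.sum fun j _ => (hA i j).mul ((hc i).mul (hc j))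
  have hs : ContDiffAt ℝ ∞ (fun p : Coord n × Coord n => sv (A p.1) (b p.1) p.2) (u, y) :=
    (ContDiffAt.sum fun i _ => (hb i).mul (hc i)).div hq (h.isMetric.alp_pos hy).ne'
  exact (hq.mul (ContDiffAt.comp (u, y) (f := fun p : Coord n × Coord n =>
    (nsq (A p.1) (b p.1), sv (A p.1) (b p.1) p.2)) hφ (hT.prodMk hs))).pow 2

/-- The connection coefficients `Nᵏ_m = Γᵏ_mi zⁱ`. -/
def _root_.GenAB.conn (A : Coord n → Matrix (Fin n) (Fin n) ℝ) (u z : Coord n) (k m : Fin n) : ℝ :=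
  ∑ i, christoffel A u k m i * z i

theorem pd_A_symm (h : IsConformalAt A b c u) (m i j : Fin n) :
    pd m (fun v => A v i j) u = pd m (fun v => A v j i) u :=
  congrArg (fun f => pd m f u) (funext fun v => h.symm v i j)

theorem christoffel_symm (h : IsConformalAt A b c u) (k i j : Fin n) :
    christoffel A u k i j = christoffel A u k j i := by
  rw [christoffel, christoffel]
  congr 1
  refine Finset.sum_congr rfl fun l _ => ?_
  rw [h.pd_A_symm l i j]
  ring

theorem sum_mul_christoffel (h : IsConformalAt A b c u) (p i j : Fin n) :
    ∑ k, A u p k * christoffel A u k i j =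
      1 / 2 * (pd i (fun v => A v j p) u + pd j (fun v => A v i p) u - pd p (fun v => A v i j) u) := by
  set V : Fin n → ℝ := fun l =>
    pd i (fun v => A v j l) u + pd j (fun v => A v i l) u - pd l (fun v => A v i j) u
  have h1 : (fun k => christoffel A u k i j) = (1 / 2 : ℝ) • ((A u)⁻¹ *ᵥ V) := rfl
  have h2 : A u *ᵥ (fun k => christoffel A u k i j) = (1 / 2 : ℝ) • V := by
    rw [h1, mulVec_smul, mulVec_mulVec, mul_nonsing_inv _ h.isMetric.isUnit_det, one_mulVec]
  exact congrFun h2 p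

/-- Metric compatibility of the Levi-Civita connection: add two lowered Christoffel symbols. -/
theorem pd_A (h : IsConformalAt A b c u) (m i j : Fin n) :
    pd m (fun v => A v i j) u =
      ∑ k, (A u j k * christoffel A u k m i + A u i k * christoffel A u k m j) := by
  rw [Finset.sum_add_distrib, h.sum_mul_christoffel, h.sum_mul_christoffel, h.pd_A_symm m j i,
    h.pd_A_symm i m j, h.pd_A_symm j m i]
  rw [h.pd_A_symm i j m, h.pd_A_symm j i m]
  ring

theorem pd_b (h : IsConformalAt A b c u) (m i : Fin n) :
    pd m (fun v => b v i) u = c * A u i m + ∑ k, christoffel A u k m i * b u k := by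
  have := h.conf i m
  rw [covDeriv] at this
  simp only [h.christoffel_symm _ m i]
  linarith

theorem hasPd_A (h : IsConformalAt A b c u) (m i j : Fin n) :
    HasPd m (fun v => A v i j)
      (∑ k, (A u j k * christoffel A u k m i + A u i k * christoffel A u k m j)) u :=
  ⟨(h.smooth_A i j).differentiableAt (by simp), h.pd_A m i j⟩

theorem hasPd_b (h : IsConformalAt A b c u) (m i : Fin n) :
    HasPd m (fun v => b v i) (c * A u i m + ∑ k, christoffel A u k m i * b u k) u :=
  ⟨(h.smooth_b i).differentiableAt (by simp), h.pd_b m i⟩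

theorem hasPd_base_quad (h : IsConformalAt A b c u) (z : Coord n) (m : Fin n) :
    HasPd m (fun v => quad (A v) z) (2 * ∑ k, conn A u z k m * ∑ i, A u i k * z i) u := by
  refine (hasPd_sum Finset.univ fun i _ => hasPd_sum Finset.univ fun j _ =>
    (h.hasPd_A m i j).mul (hasPd_const m (z i * z j) u)).congr_val ?_
  have e1 : ∑ k, conn A u z k m * ∑ i, A u i k * z i =
      ∑ i, ∑ j, ∑ k, A u i k * christoffel A u k m j * (z i * z j) := by
    have : ∀ k, conn A u z k m * ∑ i, A u i k * z i =
        ∑ i, ∑ j, A u i k * christoffel A u k m j * (z i * z j) := fun k => by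
      rw [conn, Finset.sum_mul_sum, Finset.sum_comm]
      exact Finset.sum_congr rfl fun i _ => Finset.sum_congr rfl fun j _ => by ring
    simp only [this]
    rw [Finset.sum_comm]
    exact Finset.sum_congr rfl fun i _ => Finset.sum_comm
  have e2 : ∑ i, ∑ j, ∑ k, A u j k * christoffel A u k m i * (z i * z j) =
      ∑ i, ∑ j, ∑ k, A u i k * christoffel A u k m j * (z i * z j) := by
    rw [Finset.sum_comm]
    exact Finset.sum_congr rfl fun i _ => Finset.sum_congr rfl fun j _ =>
      Finset.sum_congr rfl fun k _ => by ring
  rw [e1, two_mul]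
  nth_rw 1 [← e2]
  simp only [mul_zero, add_zero, Finset.sum_add_distrib, add_mul, Finset.sum_mul]

theorem hasPd_base_lin (h : IsConformalAt A b c u) (z : Coord n) (m : Fin n) :
    HasPd m (fun v => ∑ i, b v i * z i)
      (c * ∑ i, A u i m * z i + ∑ k, conn A u z k m * b u k) u := by
  refine (hasPd_sum Finset.univ fun i _ =>
    (h.hasPd_b m i).mul (hasPd_const m (z i) u)).congr_val ?_
  simp only [mul_zero, add_zero, add_mul, Finset.sum_add_distrib, Finset.mul_sum, Finset.sum_mul,
    conn]
  congr 1
  · exact Finset.sum_congr rfl fun i _ => by ring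
  · rw [Finset.sum_comm]
    exact Finset.sum_congr rfl fun i _ => Finset.sum_congr rfl fun k _ => by ring

theorem hasPd_base_alp (h : IsConformalAt A b c u) {z : Coord n} (hz : z ≠ 0) (m : Fin n) :
    HasPd m (fun v => alp (A v) z) (∑ k, conn A u z k m * lv (A u) z k) u := by
  have h0 := (h.isMetric.alp_pos hz).ne'
  refine (HasPd.comp (f := fun v => quad (A v) z)
    (Real.hasDerivAt_sqrt (h.pos z hz).ne') (h.hasPd_base_quad z m)).congr_val ?_
  have e : ∑ k, conn A u z k m * lv (A u) z k =
      (∑ k, conn A u z k m * ∑ i, A u i k * z i) / alp (A u) z := by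
    rw [Finset.sum_div]
    exact Finset.sum_congr rfl fun k _ => by rw [lv, mul_div_assoc]
  rw [e, ← alp]
  field_simp

theorem hasPd_base_sv (h : IsConformalAt A b c u) {z : Coord n} (hz : z ≠ 0) (m : Fin n) :
    HasPd m (fun v => sv (A v) (b v) z)
      (c * lv (A u) z m + (∑ k, conn A u z k m * mv (A u) (b u) z k) / alp (A u) z) u := by
  have h0 := (h.isMetric.alp_pos hz).ne'
  refine ((h.hasPd_base_lin z m).div (h.hasPd_base_alp hz m) h0).congr_val ?_
  have e : ∑ k, conn A u z k m * mv (A u) (b u) z k = ∑ k, conn A u z k m * b u k -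
      sv (A u) (b u) z * ∑ k, conn A u z k m * lv (A u) z k := by
    rw [Finset.mul_sum, ← Finset.sum_sub_distrib]
    exact Finset.sum_congr rfl fun k _ => by rw [mv]; ring
  rw [e, sv, lv]
  field_simp
  ring

/-- With x = A⁻¹b one has b² = 2 b·x - xᵀAx, and x is the critical point of the right side. So the
derivative can be taken as if x were frozen at its value w; the connection terms then cancel and 2c
Aw = 2c b remains. -/
theorem hasPd_base_nsq (h : IsConformalAt A b c u) (m : Fin n) :
    HasPd m (fun v => nsq (A v) (b v)) (2 * c * b u m) u := by
  have hd := h.isMetric.isUnit_det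
  set w : Coord n := WithLp.toLp 2 ((A u)⁻¹ *ᵥ b u) with hw
  have hAw : ∀ j, ∑ i, A u i j * w i = b u j := fun j => by
    have : A u *ᵥ ((A u)⁻¹ *ᵥ b u) = b u := by rw [mulVec_mulVec, mul_nonsing_inv _ hd, one_mulVec]
    rw [← congrFun this j]
    exact Finset.sum_congr rfl fun i _ => by rw [h.symm u i j]
  set x : Coord n → Coord n := fun v => WithLp.toLp 2 ((A v)⁻¹ *ᵥ b v) with hx
  have hxd (i : Fin n) : DifferentiableAt ℝ (fun v => x v i) u := by
    refine ContDiffAt.differentiableAt (n := ∞) ?_ (by simp)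
    exact ContDiffAt.sum (s := Finset.univ) (f := fun j v => (A v)⁻¹ i j * b v j) fun j _ =>
      (contDiffAt_inv h.smooth_A hd i j).mul (h.smooth_b j)
  have hP (i : Fin n) : HasPd m (fun v => x v i) (pd m (fun v => x v i) u) u := ⟨hxd i, rfl⟩
  have hPA (i j : Fin n) : HasPd m (fun v => A v i j) (pd m (fun v => A v i j) u) u :=
    ⟨(h.hasPd_A m i j).1, rfl⟩
  have hPb (i : Fin n) : HasPd m (fun v => b v i) (pd m (fun v => b v i) u) u :=
    ⟨(h.hasPd_b m i).1, rfl⟩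
  have hdet : ∀ᶠ v in nhds u, IsUnit (A v).det := by
    have h1 : ContinuousAt (fun v => (A v).det) u :=
      (contDiffAt_det h.smooth_A (N := ∞)).continuousAt
    filter_upwards [h1.eventually_ne hd.ne_zero] with v hv using hv.isUnit
  have key : (fun v => nsq (A v) (b v)) =ᶠ[nhds u]
      fun v => 2 * (∑ i, b v i * x v i) - ∑ i, ∑ j, A v i j * (x v i * x v j) := by
    filter_upwards [hdet] with v hv
    have e1 : ∑ i, b v i * x v i = nsq (A v) (b v) := rfl
    have e2 : ∑ i, ∑ j, A v i j * (x v i * x v j) = nsq (A v) (b v) := by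
      change quad (A v) (x v) = _
      rw [quad_eq, hx, mulVec_mulVec, mul_nonsing_inv _ hv, one_mulVec, dotProduct_comm, nsq]
    rw [e1, e2]
    ring
  have hq := hasPd_sum Finset.univ fun i _ => hasPd_sum Finset.univ fun j _ =>
    (hPA i j).mul ((hP i).mul (hP j))
  have hl := hasPd_sum Finset.univ fun i _ => (hPb i).mul (hP i)
  refine (((hl.const_mul 2).sub hq).congr_fun key).congr_val ?_
  -- The frozen derivatives, each evaluated in two ways: termwise, and by the formulas with
  -- connection terms at z = w.
  have q1 := (hasPd_sum Finset.univ fun i _ => hasPd_sum Finset.univ fun j _ =>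
    (hPA i j).mul (hasPd_const m (w i * w j) u)).2.symm.trans (h.hasPd_base_quad w m).2
  have q2 := (hasPd_sum Finset.univ fun i _ =>
    (hPb i).mul (hasPd_const m (w i) u)).2.symm.trans (h.hasPd_base_lin w m).2
  have hxu : x u = w := rfl
  simp only [mul_zero, add_zero, hAw] at q1 q2
  simp only [hxu, Finset.sum_add_distrib, mul_add, q1, q2]
  have e3 : ∑ i, ∑ j, A u i j * (pd m (fun v => x v i) u * w j) =
      ∑ i, b u i * pd m (fun v => x v i) u := by
    refine Finset.sum_congr rfl fun i _ => ?_
    rw [← hAw i, Finset.sum_mul]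
    exact Finset.sum_congr rfl fun j _ => by rw [h.symm u i j]; ring
  have e4 : ∑ i, ∑ j, A u i j * (w i * pd m (fun v => x v j) u) =
      ∑ i, b u i * pd m (fun v => x v i) u := by
    rw [Finset.sum_comm]
    refine Finset.sum_congr rfl fun j _ => ?_
    rw [← hAw j, Finset.sum_mul]
    exact Finset.sum_congr rfl fun i _ => by ring
  rw [e3, e4]
  ring

/-- The part of `∂F²/∂xᵐ` coming from the covariant derivatives of `β` and `b²`. -/
def _root_.GenAB.horiz (A : Matrix (Fin n) (Fin n) ℝ) (b : Fin n → ℝ) (φ : ℝ → ℝ → ℝ) (c : ℝ)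
    (z : Coord n) (m : Fin n) : ℝ :=
  2 * c * alp A z ^ 2 * φ (nsq A b) (sv A b z) *
    (d2 φ (nsq A b) (sv A b z) * lv A z m + 2 * d1 φ (nsq A b) (sv A b z) * b m)

theorem hasPd_base_localF_sq (h : IsConformalAt A b c u) {φ : ℝ → ℝ → ℝ}
    (hφ : ∀ z : Coord n, z ≠ 0 → SmoothAt φ (nsq (A u) (b u)) (sv (A u) (b u) z))
    {z : Coord n} (hz : z ≠ 0) (m : Fin n) :
    HasPd m (fun v => localF A b φ v z ^ 2)
      (∑ k, conn A u z k m * pd k (fun z => localF A b φ u z ^ 2) z +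
        horiz (A u) (b u) φ c z m) u := by
  have h0 := (h.isMetric.alp_pos hz).ne'
  have hF := (h.hasPd_base_alp hz m).mul
    (HasPd.comp₂ (hφ z hz).differentiableAt (h.hasPd_base_nsq m) (h.hasPd_base_sv hz m))
  refine ((hF.mul hF).congr_fun (.of_forall fun v => by simp only [localF]; ring)).congr_val ?_
  set α := alp (A u) z
  set f := φ (nsq (A u) (b u)) (sv (A u) (b u) z)
  set f2 := d2 φ (nsq (A u) (b u)) (sv (A u) (b u) z)
  have e : ∑ k, conn A u z k m * pd k (fun z => localF A b φ u z ^ 2) z =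
      2 * α * f * (f * ∑ k, conn A u z k m * lv (A u) z k +
        f2 * ∑ k, conn A u z k m * mv (A u) (b u) z k) := by
    rw [Finset.mul_sum, Finset.mul_sum, ← Finset.sum_add_distrib, Finset.mul_sum]
    refine Finset.sum_congr rfl fun k _ => ?_
    rw [(hasPd_localF_sq h.isMetric hφ hz k).2]
    simp only [dualv, Pi.add_apply, Pi.smul_apply, smul_eq_mul]
    ring
  rw [e, horiz]
  field_simp
  ring

end IsConformalAt

end Base

/-! ### Spray coefficients and mean Landsberg curvature in local coordinates -/

section Curvature

open Matrix

variable {n : ℕ} {A : Coord n → Matrix (Fin n) (Fin n) ℝ} {b : Coord n → Fin n → ℝ} {c : ℝ}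
  {u : Coord n} {b₀ : EReal} {φ : ℝ → ℝ → ℝ}

namespace IsConformalAt

theorem sum_mul_horiz (h : IsConformalAt A b c u) (φ : ℝ → ℝ → ℝ) {z : Coord n} (hz : z ≠ 0) :
    ∑ m, z m * horiz (A u) (b u) φ c z m =
      c * (alp (A u) z ^ 3 * (2 * φ (nsq (A u) (b u)) (sv (A u) (b u) z) *
        (d2 φ (nsq (A u) (b u)) (sv (A u) (b u) z) +
          2 * (sv (A u) (b u) z * d1 φ (nsq (A u) (b u)) (sv (A u) (b u) z))))) := by
  have h0 := (h.isMetric.alp_pos hz).ne'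
  have e1 : ∑ m, lv (A u) z m * z m = alp (A u) z := by
    have := (isFrame h.isMetric (b u) hz).l_l
    rw [lUp, dotProduct_smul, smul_eq_mul, inv_mul_eq_one₀ h0] at this
    exact this.symm
  have e2 : ∑ m, b u m * z m = sv (A u) (b u) z * alp (A u) z := by
    rw [sv, div_mul_cancel₀ _ h0]
  set f := φ (nsq (A u) (b u)) (sv (A u) (b u) z)
  set f2 := d2 φ (nsq (A u) (b u)) (sv (A u) (b u) z)
  set f1 := d1 φ (nsq (A u) (b u)) (sv (A u) (b u) z)
  have : ∀ m, z m * horiz (A u) (b u) φ c z m =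
      2 * c * alp (A u) z ^ 2 * f * f2 * (lv (A u) z m * z m) +
      4 * c * alp (A u) z ^ 2 * f * f1 * (b u m * z m) := fun m => by
    rw [horiz]; ring
  simp only [this, Finset.sum_add_distrib, ← Finset.mul_sum, e1, e2]
  ring

theorem differentiableAt_horiz (h : IsConformalAt A b c u)
    (hφ : ∀ z : Coord n, z ≠ 0 → SmoothAt φ (nsq (A u) (b u)) (sv (A u) (b u) z))
    {z : Coord n} (hz : z ≠ 0) (m : Fin n) :
    DifferentiableAt ℝ (fun z => horiz (A u) (b u) φ c z m) z := by
  have ha := (hasPd_alp h.isMetric hz m).1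
  have hs := (hasPd_sv h.isMetric (b u) hz m).1
  have hl := (hasPd_lv h.isMetric hz m m).1
  have hf := (hφ z hz).hasDerivAt.differentiableAt.comp z hs
  have hf2 := (hφ z hz).d2.hasDerivAt.differentiableAt.comp z hs
  have hf1 := (hφ z hz).d1.hasDerivAt.differentiableAt.comp z hs
  exact (((ha.pow 2).const_mul (2 * c)).mul hf).mul
    ((hf2.mul hl).add ((hf1.const_mul 2).mul_const (b u m)))

/-- The left side is ∂_l(zᵐX_m) - 2X_l, and zᵐX_m is α³ times a function of s. Applying g to the
candidate vector on the right avoids inverting g: the components along `dualv` and `mv` match by the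
definitions of E and H respectively. -/
theorem sum_mul_pd_horiz (h : IsConformalAt A b c u)
    (hφ : ∀ z : Coord n, z ≠ 0 → SmoothAt φ (nsq (A u) (b u)) (sv (A u) (b u) z))
    {z : Coord n} (hz : z ≠ 0) (hf : φ (nsq (A u) (b u)) (sv (A u) (b u) z) ≠ 0)
    (hΔ : φ (nsq (A u) (b u)) (sv (A u) (b u) z) -
      sv (A u) (b u) z * d2 φ (nsq (A u) (b u)) (sv (A u) (b u) z) +
      (nsq (A u) (b u) - sv (A u) (b u) z ^ 2) *
        d2 (d2 φ) (nsq (A u) (b u)) (sv (A u) (b u) z) ≠ 0) (l : Fin n) :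
    ∑ m, z m * pd l (fun z => horiz (A u) (b u) φ c z m) z - horiz (A u) (b u) φ c z l =
      (fundMat (A u) (b u) φ z *ᵥ ((4 * c) •
        ((alp (A u) z * Efun φ (nsq (A u) (b u)) (sv (A u) (b u) z)) • z.ofLp +
        (alp (A u) z ^ 2 * Hfun φ (nsq (A u) (b u)) (sv (A u) (b u) z)) •
          ((A u)⁻¹ *ᵥ b u)))) l := by
  have hA := h.isMetric
  have h0 := (hA.alp_pos hz).ne'
  have ez : z.ofLp = alp (A u) z • lUp (A u) z := by rw [lUp, smul_inv_smul₀ h0]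
  have ew : (A u)⁻¹ *ᵥ b u = mUp (A u) (b u) z + sv (A u) (b u) z • lUp (A u) z := by
    rw [mUp, sub_add_cancel]
  have hP := (hasPd_sum Finset.univ fun m _ => (hasPd_coord l m z).mul
    (⟨h.differentiableAt_horiz hφ hz m, rfl⟩ : HasPd l _ _ z)).2
  have hT := hasPd_alp_cube_mul (b := b u) hA
    (f := fun r => 2 * φ (nsq (A u) (b u)) r *
      (d2 φ (nsq (A u) (b u)) r + 2 * (r * d1 φ (nsq (A u) (b u)) r)))
    (f1 := fun r => 2 * d2 φ (nsq (A u) (b u)) r *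
      (d2 φ (nsq (A u) (b u)) r + 2 * (r * d1 φ (nsq (A u) (b u)) r)) +
      2 * φ (nsq (A u) (b u)) r * (d2 (d2 φ) (nsq (A u) (b u)) r +
        2 * (1 * d1 φ (nsq (A u) (b u)) r + r * d2 (d1 φ) (nsq (A u) (b u)) r)))
    (fun z hz => ((hφ z hz).hasDerivAt.const_mul 2).fun_mul ((hφ z hz).d2.hasDerivAt.fun_add
      (((hasDerivAt_id' _).fun_mul (hφ z hz).d1.hasDerivAt).const_mul 2))) hz l
  rw [((hT.const_mul c).congr_ne (fun w hw => h.sum_mul_horiz φ hw) hz).2] at hP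
  simp only [Finset.sum_add_distrib, ite_mul, one_mul, zero_mul, Finset.sum_ite_eq',
    Finset.mem_univ, if_true] at hP
  generalize ∑ m, z m * pd l (fun z => horiz (A u) (b u) φ c z m) z = Q at *
  rw [ew, ez, mulVec_smul, mulVec_add, mulVec_smul, mulVec_smul, mulVec_smul, mulVec_add,
    mulVec_smul, fundMat_mulVec_lUp hA _ _ hz, fundMat_mulVec_mUp hA _ _ hz]
  simp only [dualv, Pi.add_apply, Pi.smul_apply, smul_eq_mul]
  have hb : b u l = mv (A u) (b u) z l + sv (A u) (b u) z * lv (A u) z l := by rw [mv]; ring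
  have hX : horiz (A u) (b u) φ c z l = _ := horiz.eq_1 ..
  rw [hb] at hX
  have hE : Efun φ (nsq (A u) (b u)) (sv (A u) (b u) z) = _ := Efun.eq_1 ..
  have hH : Hfun φ (nsq (A u) (b u)) (sv (A u) (b u) z) = _ := Hfun.eq_1 ..
  rw [eq_div_iff (mul_ne_zero two_ne_zero hΔ)] at hH
  have hE' := congrArg (fun x => x * (2 * φ (nsq (A u) (b u)) (sv (A u) (b u) z))) hE
  simp only [sub_mul, div_mul_cancel₀ _ (mul_ne_zero two_ne_zero hf)] at hE'
  generalize Efun φ (nsq (A u) (b u)) (sv (A u) (b u) z) = E at *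
  generalize Hfun φ (nsq (A u) (b u)) (sv (A u) (b u) z) = H at *
  generalize φ (nsq (A u) (b u)) (sv (A u) (b u) z) = f at *
  generalize d2 φ (nsq (A u) (b u)) (sv (A u) (b u) z) = f2 at *
  generalize d1 φ (nsq (A u) (b u)) (sv (A u) (b u) z) = f1 at *
  generalize d2 (d2 φ) (nsq (A u) (b u)) (sv (A u) (b u) z) = f22 at *
  generalize d2 (d1 φ) (nsq (A u) (b u)) (sv (A u) (b u) z) = f12 at *
  generalize sv (A u) (b u) z = s at *
  generalize mv (A u) (b u) z l = ml at *
  generalize lv (A u) z l = ll at *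
  generalize alp (A u) z = α at *
  generalize nsq (A u) (b u) = t at *
  have hE2 : 2 * f * E = f2 + 2 * s * f1 - 2 * H * (s * f + (t - s ^ 2) * f2) := by
    rw [mul_comm, hE']
    field_simp
  rw [hX] at hP ⊢
  -- `hE2` matches the coefficient of f l + f2 m, and `hH` the remaining coefficient of m.
  linear_combination -hP - 2 * c * α ^ 2 * (f * ll + f2 * ml) * hE2 - 2 * c * α ^ 2 * f * ml * hH

/-- Spray coefficients of a general `(α, β)`-metric with closed conformal `β`. -/
theorem spray_localF (h : IsConformalAt A b c u) (hφ : IsAdmissible n b₀ φ)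
    (hb : ((√(nsq (A u) (b u)) : ℝ) : EReal) < b₀) {z : Coord n} (hz : z ≠ 0) (i : Fin n) :
    spray (localF A b φ) u z i = 1 / 2 * quad (Matrix.of (christoffel A u i)) z +
      c * (alp (A u) z * Efun φ (nsq (A u) (b u)) (sv (A u) (b u) z) * z i +
        alp (A u) z ^ 2 * Hfun φ (nsq (A u) (b u)) (sv (A u) (b u) z) *
          ((A u)⁻¹ *ᵥ b u) i) := by
  have hA := h.isMetric
  have hr {z : Coord n} (hz : z ≠ 0) := mem_region hA hb hz
  have hsm : ∀ z : Coord n, z ≠ 0 → SmoothAt φ (nsq (A u) (b u)) (sv (A u) (b u) z) :=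
    fun z hz => hφ.smoothAt (hr hz)
  set g := fundMat (A u) (b u) φ z with hg
  set V : Fin n → ℝ := (4 * c) •
        ((alp (A u) z * Efun φ (nsq (A u) (b u)) (sv (A u) (b u) z)) • z.ofLp +
        (alp (A u) z ^ 2 * Hfun φ (nsq (A u) (b u)) (sv (A u) (b u) z)) •
          ((A u)⁻¹ *ᵥ b u)) with hV
  set Γ : Fin n → ℝ := fun k => ∑ m, conn A u z k m * z m with hΓ
  have hgs (k l : Fin n) : g k l = g l k := congrFun (congrFun (fundMat_transpose hA _ φ z) l) k
  have hΓs (k l : Fin n) : ∑ m, z m * christoffel A u k m l = conn A u z k l :=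
    Finset.sum_congr rfl fun m _ => by rw [h.christoffel_symm k m l, mul_comm]
  have key (l : Fin n) :
      (∑ m, pd m (fun v => pd l (fun z => localF A b φ v z ^ 2) z) u * z m) -
        pd l (fun v => localF A b φ v z ^ 2) u = (g *ᵥ ((2 : ℝ) • Γ + V)) l := by
    have e1 (m : Fin n) : pd m (fun v => pd l (fun z => localF A b φ v z ^ 2) z) u =
        ∑ k, (christoffel A u k m l * pd k (fun z => localF A b φ u z ^ 2) z +
          conn A u z k m * (2 * g k l)) + pd l (fun z => horiz (A u) (b u) φ c z m) z := by
      -- With the order of differentiation exchanged, the formula for ∂F²/∂xᵐ, known for all z ≠ 0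
      -- at the fixed point u, can be differentiated in z.
      rw [(pd_comm m l (f := fun v z => localF A b φ v z ^ 2)
        (by exact_mod_cast contDiffAt_infty.1 (h.contDiffAt_localF_sq hz (hsm z hz)) 2))]
      have hP := (hasPd_sum Finset.univ fun k _ => (hasPd_lin (christoffel A u k m) l z).mul
        (hasPd_pd_localF_sq hA hsm hz k l)).add
        (⟨h.differentiableAt_horiz (c := c) hsm hz m, rfl⟩ : HasPd l _ _ z)
      exact (hP.congr_ne (fun w hw => (h.hasPd_base_localF_sq hsm hw m).2) hz).2
    have e2 := h.sum_mul_pd_horiz (c := c) hsm hz (hφ.pos _ _ (hr hz)).ne'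
      (hφ.convex₂ _ _ (hr hz)).ne' l
    rw [(h.hasPd_base_localF_sq hsm hz l).2, mulVec_add, Pi.add_apply, ← e2]
    simp only [e1]
    have e3 : ∑ m, (∑ k, christoffel A u k m l * pd k (fun z => localF A b φ u z ^ 2) z) * z m =
        ∑ k, conn A u z k l * pd k (fun z => localF A b φ u z ^ 2) z := by
      simp only [← hΓs, Finset.sum_mul]
      rw [Finset.sum_comm]
      exact Finset.sum_congr rfl fun k _ => Finset.sum_congr rfl fun m _ => by ring
    have e4 : ∑ m, (∑ k, conn A u z k m * (2 * g k l)) * z m = (g *ᵥ ((2 : ℝ) • Γ)) l := by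
      simp only [mulVec, dotProduct, hΓ, Finset.sum_mul, Pi.smul_apply, smul_eq_mul, Finset.mul_sum]
      rw [Finset.sum_comm]
      exact Finset.sum_congr rfl fun k _ => Finset.sum_congr rfl fun m _ => by
        rw [hgs k l]; ring
    rw [← e4]
    simp only [Finset.sum_add_distrib, add_mul, e3]
    have e5 : ∑ m, pd l (fun z => horiz (A u) (b u) φ c z m) z * z m =
        ∑ m, z m * pd l (fun z => horiz (A u) (b u) φ c z m) z :=
      Finset.sum_congr rfl fun m _ => mul_comm _ _
    rw [e5]
    ring
  obtain ⟨σ, τ, hinv⟩ := fundMat_mul_invTensor hA hφ (hr hz) hz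
  -- The explicit inverse serves here only to show that g is invertible.
  have hu : g⁻¹ * g = 1 := by
    rw [inv_eq_right_inv hinv]; exact mul_eq_one_comm.1 hinv
  have e : spray (localF A b φ) u z i = 1 / 4 * (g⁻¹ *ᵥ (g *ᵥ ((2 : ℝ) • Γ + V))) i := by
    rw [spray, fundTensor_localF hA hsm hz, ← hg]
    simp only [key]
    rfl
  have hq : Γ i = quad (Matrix.of (christoffel A u i)) z := by
    simp only [hΓ, conn, quad, Finset.sum_mul, of_apply]
    exact Finset.sum_congr rfl fun m _ => Finset.sum_congr rfl fun k _ => by ring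
  rw [e, mulVec_mulVec, hu, one_mulVec, ← hq, hV]
  simp only [Pi.add_apply, Pi.smul_apply, smul_eq_mul]
  ring

end IsConformalAt

/-- Third derivatives of `½ Kzz + r (p zⁱ + q w)`. -/
theorem pd_pd_pd_spray_form (K : Matrix (Fin n) (Fin n) ℝ) (r w : ℝ) (i : Fin n)
    {p q : Coord n → ℝ} {p1 q1 : Fin n → Coord n → ℝ} {p2 q2 : Fin n → Fin n → Coord n → ℝ}
    {p3 q3 : Fin n → Fin n → Fin n → Coord n → ℝ}
    (hp : ∀ z, z ≠ 0 → ∀ j, HasPd j p (p1 j z) z)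
    (hp1 : ∀ z, z ≠ 0 → ∀ j k, HasPd k (p1 j) (p2 j k z) z)
    (hp2 : ∀ z, z ≠ 0 → ∀ j k l, HasPd l (p2 j k) (p3 j k l z) z)
    (hq : ∀ z, z ≠ 0 → ∀ j, HasPd j q (q1 j z) z)
    (hq1 : ∀ z, z ≠ 0 → ∀ j k, HasPd k (q1 j) (q2 j k z) z)
    (hq2 : ∀ z, z ≠ 0 → ∀ j k l, HasPd l (q2 j k) (q3 j k l z) z)
    {G : Coord n → ℝ} (hG : ∀ z, z ≠ 0 → G z = 1 / 2 * quad K z + r * (p z * z i + q z * w))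
    {y : Coord n} (hy : y ≠ 0) (j k l : Fin n) :
    pd l (pd k (pd j G)) y = r * (p3 j k l y * y i + p2 j k y * (1 : Matrix _ _ ℝ) i l +
      p2 j l y * (1 : Matrix _ _ ℝ) i k + p2 k l y * (1 : Matrix _ _ ℝ) i j + q3 j k l y * w) := by
  have hc (k : Fin n) (z : Coord n) : HasPd k (fun z => z i) ((1 : Matrix (Fin n) (Fin n) ℝ) i k) z :=
    hasPd_coord k i z
  have g1 (z : Coord n) (hz : z ≠ 0) : pd j G z = 1 / 2 * ∑ a, (K a j + K j a) * z a +
      r * ((p1 j z * z i + p z * (1 : Matrix (Fin n) (Fin n) ℝ) i j) + q1 j z * w) := by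
    refine ((((hasPd_quad' K j z).const_mul (1 / 2)).add ((((hp z hz j).mul (hc j z)).add
      ((hq z hz j).mul (hasPd_const j w z))).const_mul r)).congr_ne hG hz).2.trans ?_
    ring
  have g2 (z : Coord n) (hz : z ≠ 0) : pd k (pd j G) z = 1 / 2 * (K k j + K j k) +
      r * ((p2 j k z * z i + p1 j z * (1 : Matrix (Fin n) (Fin n) ℝ) i k +
        p1 k z * (1 : Matrix (Fin n) (Fin n) ℝ) i j) + q2 j k z * w) := by
    refine ((((hasPd_lin (fun a => K a j + K j a) k z).const_mul (1 / 2)).add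
      (((((hp1 z hz j k).mul (hc k z)).add ((hp z hz k).mul (hasPd_const k _ z))).add
      ((hq1 z hz j k).mul (hasPd_const k w z))).const_mul r)).congr_ne g1 hz).2.trans ?_
    ring
  refine (((hasPd_const l _ y).add
    ((((((hp2 y hy j k l).mul (hc l y)).add ((hp1 y hy j l).mul (hasPd_const l _ y))).add
      ((hp1 y hy k l).mul (hasPd_const l _ y))).add
      ((hq2 y hy j k l).mul (hasPd_const l w y))).const_mul r)).congr_ne g2 hy).2.trans ?_
  ring

namespace IsConformalAt

/-- The Landsberg curvature of a general `(α, β)`-metric with closed conformal `β`. -/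
theorem landsberg_localF (h : IsConformalAt A b c u) (hφ : IsAdmissible n b₀ φ)
    (hb : ((√(nsq (A u) (b u)) : ℝ) : EReal) < b₀) {y : Coord n} (hy : y ≠ 0) (j k i : Fin n) :
    let t := nsq (A u) (b u)
    let s := sv (A u) (b u) y
    let m := mv (A u) (b u) y
    let a := A u - vecMulVec (lv (A u) y) (lv (A u) y)
    let S := s * φ t s + (t - s ^ 2) * d2 φ t s
    landsberg (localF A b φ) u y j k i = -(1 / 2) * c * φ t s *
      ((d2 φ t s * (Efun φ t s - s * d2 (Efun φ) t s) - s * φ t s * d2 (d2 (Efun φ)) t s +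
          S * (d2 (Hfun φ) t s - s * d2 (d2 (Hfun φ)) t s)) *
        (a j k * m i + a j i * m k + a k i * m j) +
      (3 * d2 φ t s * d2 (d2 (Efun φ)) t s + φ t s * d2 (d2 (d2 (Efun φ))) t s +
        S * d2 (d2 (d2 (Hfun φ))) t s) * (m j * m k * m i)) := by
  intro t s m a S
  have hA := h.isMetric
  have h0 := (hA.alp_pos hy).ne'
  have hr {z : Coord n} (hz : z ≠ 0) := mem_region hA hb hz
  have hsm : ∀ z : Coord n, z ≠ 0 → SmoothAt φ (nsq (A u) (b u)) (sv (A u) (b u) z) :=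
    fun z hz => hφ.smoothAt (hr hz)
  have hE : ∀ z : Coord n, z ≠ 0 → SmoothAt (Efun φ) t (sv (A u) (b u) z) :=
    fun z hz => (hsm z hz).efun (hφ.pos _ _ (hr hz)).ne' (hφ.convex₂ _ _ (hr hz)).ne'
  have hH : ∀ z : Coord n, z ≠ 0 → SmoothAt (Hfun φ) t (sv (A u) (b u) z) :=
    fun z hz => (hsm z hz).hfun (hφ.convex₂ _ _ (hr hz)).ne'
  have hE0 := fun z hz => (hE z hz).hasDerivAt
  have hE1 := fun z hz => (hE z hz).d2.hasDerivAt
  have hE2 := fun z hz => (hE z hz).d2.d2.hasDerivAt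
  have hH0 := fun z hz => (hH z hz).hasDerivAt
  have hH1 := fun z hz => (hH z hz).d2.hasDerivAt
  have hH2 := fun z hz => (hH z hz).d2.d2.hasDerivAt
  have hB (o : Fin n) := pd_pd_pd_spray_form (Matrix.of (christoffel A u o)) c
    (((A u)⁻¹ *ᵥ b u) o) o
    (fun z hz j => hasPd_alp_mul hA hE0 hz j) (fun z hz j k => hasPd_alp_mul₂ hA hE0 hE1 hz j k)
    (fun z hz j k l => hasPd_alp_mul₃ hA hE0 hE1 hE2 hz j k l)
    (fun z hz j => hasPd_alp_sq_mul hA hH0 hz j)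
    (fun z hz j k => hasPd_alp_sq_mul₂ hA hH0 hH1 hz j k)
    (fun z hz j k l => hasPd_alp_sq_mul₃ hA hH0 hH1 hH2 hz j k l)
    (fun z hz => h.spray_localF hφ hb hz o) hy j k i
  set g := fundMat (A u) (b u) φ y with hg
  -- The lowered vector g_om yᵐ = F ∂F/∂yᵒ.
  set Y : Fin n → ℝ := (alp (A u) y * φ t s) • dualv (A u) (b u) φ y with hY
  have ey : y.ofLp = alp (A u) y • lUp (A u) y := by rw [lUp, smul_inv_smul₀ h0]
  have ew : (A u)⁻¹ *ᵥ b u = mUp (A u) (b u) y + s • lUp (A u) y := by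
    rw [mUp, sub_add_cancel]
  have hgy : g *ᵥ y.ofLp = Y := by
    rw [ey, mulVec_smul, fundMat_mulVec_lUp hA _ _ hy, smul_smul]
  have hL : landsberg (localF A b φ) u y j k i =
      -(1 / 2) * ∑ o, Y o * berwald (localF A b φ) u y o j k i := by
    rw [landsberg, fundTensor_localF hA hsm hy, ← hgy]
    simp only [mulVec, dotProduct, Finset.sum_mul]
    exact congrArg _ (Finset.sum_congr rfl fun o _ => Finset.sum_congr rfl fun m _ => by ring)
  have hYy : ∑ o, Y o * y o = alp (A u) y ^ 2 * φ t s ^ 2 := by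
    change Y ⬝ᵥ y.ofLp = _
    rw [ey, hY, smul_dotProduct, dotProduct_smul, dualv_dotProduct_lUp hA _ _ hy]
    simp only [smul_eq_mul]
    ring
  have hYw : ∑ o, Y o * ((A u)⁻¹ *ᵥ b u) o = alp (A u) y * φ t s * S := by
    change Y ⬝ᵥ ((A u)⁻¹ *ᵥ b u) = _
    rw [ew, hY, smul_dotProduct, dotProduct_add, dotProduct_smul, dualv_dotProduct_lUp hA _ _ hy,
      dualv_dotProduct_mUp hA _ _ hy]
    simp only [smul_eq_mul, S]
    ring
  have hone (x : Fin n) : ∑ o, Y o * (1 : Matrix (Fin n) (Fin n) ℝ) o x = Y x := by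
    simp [Matrix.one_apply]
  have hsum (x1 x2 x3 x4 x5 : ℝ) : ∑ o, Y o * (c * (x1 * y o + x2 * (1 : Matrix _ _ ℝ) o i +
      x3 * (1 : Matrix _ _ ℝ) o k + x4 * (1 : Matrix _ _ ℝ) o j + x5 * ((A u)⁻¹ *ᵥ b u) o)) =
      c * (x1 * (alp (A u) y ^ 2 * φ t s ^ 2) + x2 * Y i + x3 * Y k + x4 * Y j +
        x5 * (alp (A u) y * φ t s * S)) := by
    rw [← hYy, ← hYw, ← hone i, ← hone j, ← hone k]
    simp only [Finset.mul_sum, ← Finset.sum_add_distrib]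
    exact Finset.sum_congr rfl fun o _ => by ring
  rw [hL]
  simp only [berwald, hB, hsum]
  have ha (x x' : Fin n) : hv (A u) y x x' = a x x' := rfl
  simp only [hY, dualv, Pi.add_apply, Pi.smul_apply, smul_eq_mul, ha]
  change _ * (_ * (_ + _ + _ + _ + _)) = _
  -- The l-terms of the third derivative of αE, multiplied by y_i yⁱ = α²φ², cancel against the φ l
  -- part of Y multiplied by its second derivatives.
  field_simp
  ring

end IsConformalAt

/-- The mean Landsberg curvature of a general `(α, β)`-metric with closed conformal `β`. -/
theorem IsConformalAt.meanLandsberg_localF (h : IsConformalAt A b c u) (hφ : IsAdmissible n b₀ φ)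
    (hb : ((√(nsq (A u) (b u)) : ℝ) : EReal) < b₀) {y : Coord n} (hy : y ≠ 0) (j : Fin n) :
    let t := nsq (A u) (b u)
    let s := sv (A u) (b u) y
    meanLandsberg (localF A b φ) u y j =
      -(c * φ t s / (2 * rho φ t s)) * (Wscalar n φ t s * mv (A u) (b u) y j) := by
  intro t s
  have hA := h.isMetric
  have hr {z : Coord n} (hz : z ≠ 0) := mem_region hA hb hz
  have hsm : ∀ z : Coord n, z ≠ 0 → SmoothAt φ (nsq (A u) (b u)) (sv (A u) (b u) z) :=
    fun z hz => hφ.smoothAt (hr hz)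
  obtain ⟨σ, τ, hinv⟩ := fundMat_mul_invTensor hA hφ (hr hy) hy
  rw [meanLandsberg, fundTensor_localF hA hsm hy, inv_eq_right_inv hinv]
  simp only [h.landsberg_localF hφ hb hy]
  simp only [mul_left_comm _ (-(1 / 2) * c * φ _ _) _, ← Finset.mul_sum]
  rw [(isFrame hA (b u) hy).contract]
  have hρ : rho φ (nsq (A u) (b u)) (sv (A u) (b u) y) ≠ 0 :=
    mul_ne_zero (hφ.pos _ _ (hr hy)).ne' (hφ.sub_mul_pos (hr hy)).ne'
  simp only [Wscalar, t, s]
  field_simp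
  ring

end Curvature

/-! ### Passage to local coordinates -/

section Chart

open Matrix Bundle

variable {n : ℕ} {M : Type*} [TopologicalSpace M] [ChartedSpace (Coord n) M]
  {e : OpenPartialHomeomorph M (Coord n)}

theorem mdifferentiable_of_mem_maximalAtlas (he : e ∈ IsManifold.maximalAtlas (𝓡 n) ∞ M) :
    e.MDifferentiable (𝓡 n) (𝓡 n) :=
  ⟨(contMDiffOn_of_mem_maximalAtlas he).mdifferentiableOn (by simp),
    (contMDiffOn_symm_of_mem_maximalAtlas he).mdifferentiableOn (by simp)⟩

theorem chartVec_eq_sum (e : OpenPartialHomeomorph M (Coord n)) (u z : Coord n) :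
    chartVec e u z = ∑ i, z i • chartVec e u (EuclideanSpace.single i 1) := by
  have hz : z = ∑ i, z i • (EuclideanSpace.single i 1 : Coord n) := by
    ext k
    simp [Pi.single_apply]
  simp only [chartVec]
  conv_lhs => rw [hz]
  exact (map_sum (mfderiv (𝓡 n) (𝓡 n) e.symm u) _ _).trans
    (Finset.sum_congr rfl fun i _ => map_smul (mfderiv (𝓡 n) (𝓡 n) e.symm u) _ _)

theorem chartVec_ne_zero (he : e ∈ IsManifold.maximalAtlas (𝓡 n) ∞ M) {u : Coord n}
    (hu : u ∈ e.target) {z : Coord n} (hz : z ≠ 0) : chartVec e u z ≠ 0 := by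
  intro h
  have h1 := (mdifferentiable_of_mem_maximalAtlas he).comp_symm_deriv hu
  have h2 := congrArg (fun f : Coord n →L[ℝ] Coord n => f z) h1
  refine hz (h2.symm.trans ?_)
  change mfderiv (𝓡 n) (𝓡 n) e (e.symm u) (chartVec e u z) = 0
  rw [h, map_zero]

theorem chartVec_surjective (he : e ∈ IsManifold.maximalAtlas (𝓡 n) ∞ M) {u : Coord n}
    (hu : u ∈ e.target) (v : TangentSpace (𝓡 n) (e.symm u)) : ∃ z, chartVec e u z = v := by
  have h1 := (mdifferentiable_of_mem_maximalAtlas he).symm_comp_deriv (e.map_target hu)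
  rw [e.right_inv hu] at h1
  exact ⟨mfderiv (𝓡 n) (𝓡 n) e (e.symm u) v,
    congrArg (fun f : TangentSpace (𝓡 n) (e.symm u) →L[ℝ] TangentSpace (𝓡 n) (e.symm u) => f v) h1⟩

variable [IsManifold (𝓡 n) ∞ M]

/-- This field is the tangent map of `e.symm` applied to a constant vector field. It yields the
smooth frame in which the coefficients of α and β are smooth. -/
theorem contMDiffAt_chartVec (he : e ∈ IsManifold.maximalAtlas (𝓡 n) ∞ M) {u : Coord n}
    (hu : u ∈ e.target) (w : Coord n) :
    ContMDiffAt (𝓡 n) ((𝓡 n).prod (𝓡 n)) ∞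
      (fun v => TotalSpace.mk' (Coord n) (E := fun x : M => TangentSpace (𝓡 n) x)
        (e.symm v) (chartVec e v w)) u := by
  have h1 := (contMDiffOn_symm_of_mem_maximalAtlas he).contMDiffOn_tangentMapWithin
    (m := ∞) (by simp) e.open_target.uniqueMDiffOn
  have h2 : ContMDiffAt (𝓡 n) (𝓡 n).tangent ∞
      (fun v : Coord n => (⟨v, w⟩ : TangentBundle (𝓡 n) (Coord n))) u :=
    contMDiffAt_vectorSpace_iff_contDiffAt.2 contDiffAt_const
  have h3 := (h1.contMDiffAt (x := ⟨u, w⟩)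
    ((e.open_target.preimage (FiberBundle.continuous_proj _ _)).mem_nhds hu)).comp u h2
  refine h3.congr_of_eventuallyEq ?_
  filter_upwards [e.open_target.mem_nhds hu] with v hv
  simp only [Function.comp, tangentMapWithin, chartVec, mfderivWithin_of_isOpen e.open_target hv]

theorem contDiffAt_metricCoeff (a : RiemMetric n M) (he : e ∈ IsManifold.maximalAtlas (𝓡 n) ∞ M)
    {u : Coord n} (hu : u ∈ e.target) (i j : Fin n) :
    ContDiffAt ℝ ∞ (fun v => metricCoeff a e v i j) u := by
  have h1 := (a.contMDiff (e.symm u)).comp u (contMDiffAt_symm_of_mem_maximalAtlas he hu)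
  have h2 := ContMDiffAt.clm_bundle_apply₂ (F₁ := Coord n) (F₂ := Coord n) (F₃ := ℝ)
    (E₁ := fun x : M => TangentSpace (𝓡 n) x) (E₂ := fun x : M => TangentSpace (𝓡 n) x)
    (E₃ := Bundle.Trivial M ℝ) h1
    (contMDiffAt_chartVec he hu (EuclideanSpace.single i 1))
    (contMDiffAt_chartVec he hu (EuclideanSpace.single j 1))
  rw [contMDiffAt_totalSpace] at h2
  exact contMDiffAt_iff_contDiffAt.1 h2.2

theorem contDiffAt_formCoeff (β : OneForm n M) (he : e ∈ IsManifold.maximalAtlas (𝓡 n) ∞ M)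
    {u : Coord n} (hu : u ∈ e.target) (i : Fin n) :
    ContDiffAt ℝ ∞ (fun v => formCoeff β e v i) u := by
  have h1 := (β.contMDiff (e.symm u)).comp u (contMDiffAt_symm_of_mem_maximalAtlas he hu)
  have h2 := ContMDiffAt.clm_bundle_apply (F₁ := Coord n) (F₂ := ℝ)
    (E₁ := fun x : M => TangentSpace (𝓡 n) x) (E₂ := Bundle.Trivial M ℝ) h1
    (contMDiffAt_chartVec he hu (EuclideanSpace.single i 1))
  rw [contMDiffAt_totalSpace] at h2
  exact contMDiffAt_iff_contDiffAt.1 h2.2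

theorem inner_chartVec (a : RiemMetric n M) (e : OpenPartialHomeomorph M (Coord n))
    (u z : Coord n) :
    a.inner (e.symm u) (chartVec e u z) (chartVec e u z) = quad (metricCoeff a e u) z := by
  rw [chartVec_eq_sum e u z]
  simp only [quad, metricCoeff, of_apply, map_sum, map_smul, _root_.sum_apply, _root_.smul_apply,
    smul_eq_mul, Finset.mul_sum]
  rw [Finset.sum_comm]
  exact Finset.sum_congr rfl fun i _ => Finset.sum_congr rfl fun j _ => by ring

theorem alphaNorm_chartVec (a : RiemMetric n M) (e : OpenPartialHomeomorph M (Coord n))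
    (u z : Coord n) :
    alphaNorm a (e.symm u) (chartVec e u z) = alp (metricCoeff a e u) z := by
  rw [alphaNorm, inner_chartVec, alp]

theorem form_chartVec (β : OneForm n M) (e : OpenPartialHomeomorph M (Coord n)) (u z : Coord n) :
    β (e.symm u) (chartVec e u z) = ∑ i, formCoeff β e u i * z i := by
  rw [chartVec_eq_sum e u z, map_sum]
  simp only [formCoeff, map_smul, smul_eq_mul]
  exact Finset.sum_congr rfl fun i _ => mul_comm _ _

theorem isMetric_metricCoeff (a : RiemMetric n M) (he : e ∈ IsManifold.maximalAtlas (𝓡 n) ∞ M)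
    {u : Coord n} (hu : u ∈ e.target) : IsMetric (metricCoeff a e u) := by
  refine ⟨fun i j => a.symm _ _ _, fun z hz => ?_⟩
  rw [← inner_chartVec]
  exact a.pos _ _ (chartVec_ne_zero he hu hz)

/-- The bound is Cauchy–Schwarz (`sv_sq_le`). It is attained at A⁻¹b normalized, or at 0 when the
norm of b is zero. -/
theorem isGreatest_sqrt_nsq {A : Matrix (Fin n) (Fin n) ℝ} (hA : IsMetric A) (b : Fin n → ℝ) :
    IsGreatest {r : ℝ | ∃ z : Coord n, alp A z ≤ 1 ∧ r = |∑ i, b i * z i|} √(nsq A b) := by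
  constructor
  · set w : Coord n := WithLp.toLp 2 (A⁻¹ *ᵥ b) with hw
    have hbw : ∑ i, b i * w i = nsq A b := rfl
    have hq : quad A w = nsq A b := by
      rw [quad_eq, hw, mulVec_mulVec, mul_nonsing_inv _ hA.isUnit_det, one_mulVec, dotProduct_comm,
        nsq]
    rcases (nsq_nonneg hA b).eq_or_lt with h0 | h0
    · exact ⟨0, by simp [alp, quad], by simp [← h0]⟩
    · have hr := Real.sqrt_pos.2 h0
      refine ⟨(√(nsq A b))⁻¹ • w, ?_, ?_⟩
      · have : quad A ((√(nsq A b))⁻¹ • w) = 1 := by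
          rw [quad_eq, WithLp.ofLp_smul, mulVec_smul, smul_dotProduct, dotProduct_smul, ← quad_eq, hq]
          simp only [smul_eq_mul]
          field_simp
          rw [Real.sq_sqrt h0.le]
        rw [alp, this, Real.sqrt_one]
      · have : ∑ i, b i * ((√(nsq A b))⁻¹ • w) i = √(nsq A b) := by
          simp only [PiLp.smul_apply, smul_eq_mul, mul_left_comm _ (√(nsq A b))⁻¹, ← Finset.mul_sum,
            hbw]
          rw [inv_mul_eq_div, Real.div_sqrt]
        rw [this, abs_of_pos hr]
  · rintro r ⟨z, hz, rfl⟩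
    rcases eq_or_ne z 0 with rfl | h0
    · simp
    have hp := hA.alp_pos h0
    have h1 := Real.abs_le_sqrt (sv_sq_le hA b h0)
    rw [sv, abs_div, abs_of_pos hp, div_le_iff₀ hp] at h1
    exact h1.trans (mul_le_of_le_one_right (Real.sqrt_nonneg _) hz)

/-- Every tangent vector at the point is a coordinate vector, so the intrinsic supremum is the one
computed in coordinates. -/
theorem formNorm_eq (a : RiemMetric n M) (β : OneForm n M)
    (he : e ∈ IsManifold.maximalAtlas (𝓡 n) ∞ M) {u : Coord n} (hu : u ∈ e.target) :
    formNorm a β (e.symm u) = √(nsq (metricCoeff a e u) (formCoeff β e u)) := by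
  rw [formNorm, ← (isGreatest_sqrt_nsq (isMetric_metricCoeff a he hu) (formCoeff β e u)).csSup_eq]
  congr 1
  ext r
  constructor
  · rintro ⟨v, hv, rfl⟩
    obtain ⟨z, rfl⟩ := chartVec_surjective he hu v
    exact ⟨z, by rwa [← alphaNorm_chartVec], by rw [form_chartVec]⟩
  · rintro ⟨z, hz, rfl⟩
    exact ⟨chartVec e u z, by rwa [alphaNorm_chartVec], by rw [form_chartVec]⟩

theorem formNorm_sq (a : RiemMetric n M) (β : OneForm n M)
    (he : e ∈ IsManifold.maximalAtlas (𝓡 n) ∞ M) {u : Coord n} (hu : u ∈ e.target) :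
    formNorm a β (e.symm u) ^ 2 = nsq (metricCoeff a e u) (formCoeff β e u) := by
  rw [formNorm_eq a β he hu, Real.sq_sqrt (nsq_nonneg (isMetric_metricCoeff a he hu) _)]

theorem inChart_metricAB (a : RiemMetric n M) (β : OneForm n M) (φ : ℝ → ℝ → ℝ)
    (he : e ∈ IsManifold.maximalAtlas (𝓡 n) ∞ M) {u : Coord n} (hu : u ∈ e.target) :
    inChart e (metricAB a β φ) u = localF (metricCoeff a e) (formCoeff β e) φ u := by
  ext z
  rw [inChart, metricAB, localF, formNorm_sq a β he hu, alphaNorm_chartVec, form_chartVec, sv]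

theorem isConformalAt_of_isClosedConformal {a : RiemMetric n M} {β : OneForm n M} {c : M → ℝ}
    (hc : IsClosedConformal a β c) (he : e ∈ IsManifold.maximalAtlas (𝓡 n) ∞ M) {u : Coord n}
    (hu : u ∈ e.target) :
    IsConformalAt (metricCoeff a e) (formCoeff β e) (c (e.symm u)) u where
  symm _ _ _ := a.symm _ _ _
  pos := (isMetric_metricCoeff a he hu).pos
  smooth_A := contDiffAt_metricCoeff a he hu
  smooth_b := contDiffAt_formCoeff β he hu
  conf := hc e he u hu

end Chart

/-- The mean Landsberg curvature at `u` depends only on the germ of `F` at `u`. -/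
theorem meanLandsberg_congr {n : ℕ} {F F' : Coord n → Coord n → ℝ} {u : Coord n}
    (h : ∀ᶠ v in nhds u, F v = F' v) (y : Coord n) (j : Fin n) :
    meanLandsberg F u y j = meanLandsberg F' u y j := by
  have hg : fundTensor F u = fundTensor F' u := by
    ext z k l
    simp only [fundTensor, h.self_of_nhds]
  have hs : spray F u = spray F' u := by
    ext z i
    have e1 (l : Fin n) : (fun v => pd l (fun z => F v z ^ 2) z) =ᶠ[nhds u]
        fun v => pd l (fun z => F' v z ^ 2) z := by
      filter_upwards [h] with v hv
      rw [hv]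
    have e2 : (fun v => F v z ^ 2) =ᶠ[nhds u] fun v => F' v z ^ 2 := by
      filter_upwards [h] with v hv
      rw [hv]
    simp only [spray, hg, pd, e2.fderiv_eq]
    simp only [pd] at e1
    simp only [(e1 _).fderiv_eq]
  simp only [meanLandsberg, landsberg, berwald, hg, hs]

end GenAB
end

theorem mainTheorem4 {n : ℕ} (hn : 2 ≤ n) {M : Type*} [TopologicalSpace M]
    [ChartedSpace (GenAB.Coord n) M] [IsManifold (𝓡 n) ∞ M]
    (a : GenAB.RiemMetric n M) (β : GenAB.OneForm n M)
    (b₀ : EReal) (φ : ℝ → ℝ → ℝ) (hφ : GenAB.IsAdmissible n b₀ φ)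
    (hβ : ∀ x : M, (GenAB.formNorm a β x : EReal) < b₀)
    (c : M → ℝ) (hc : GenAB.IsClosedConformal a β c)
    (e : OpenPartialHomeomorph M (GenAB.Coord n))
    (he : e ∈ IsManifold.maximalAtlas (𝓡 n) ∞ M)
    (u : GenAB.Coord n) (hu : u ∈ e.target) (y : GenAB.Coord n) (hy : y ≠ 0) (j : Fin n) :
    let α : ℝ := GenAB.alphaNorm a (e.symm u) (GenAB.chartVec e u y)
    let t : ℝ := GenAB.formNorm a β (e.symm u) ^ 2
    let s : ℝ := β (e.symm u) (GenAB.chartVec e u y) / α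
    let l : Fin n → ℝ := fun k => ∑ i, GenAB.metricCoeff a e u i k * (y i / α)
    let W : Fin n → ℝ := fun k =>
      GenAB.Wscalar n φ t s * (GenAB.formCoeff β e u k - s * l k)
    GenAB.meanLandsberg (GenAB.inChart e (GenAB.metricAB a β φ)) u y j =
      -(c (e.symm u) * φ t s / (2 * GenAB.rho φ t s)) * W j := by
  intro α t s l W
  have hα : α = GenAB.alp (GenAB.metricCoeff a e u) y := GenAB.alphaNorm_chartVec a e u y
  have ht : t = GenAB.nsq (GenAB.metricCoeff a e u) (GenAB.formCoeff β e u) :=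
    GenAB.formNorm_sq a β he hu
  have hs : s = GenAB.sv (GenAB.metricCoeff a e u) (GenAB.formCoeff β e u) y := by
    rw [GenAB.sv, ← hα, ← GenAB.form_chartVec]
  have hl : l j = GenAB.lv (GenAB.metricCoeff a e u) y j := by
    rw [GenAB.lv, ← hα, Finset.sum_div]
    exact Finset.sum_congr rfl fun i _ => (mul_div_assoc _ _ _).symm
  -- The spray differentiates F in the base variable, so the coordinate expression is needed near u
  -- and not only at u.
  have hF : ∀ᶠ v in nhds u, GenAB.inChart e (GenAB.metricAB a β φ) v =
      GenAB.localF (GenAB.metricCoeff a e) (GenAB.formCoeff β e) φ v := by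
    filter_upwards [e.open_target.mem_nhds hu] with v hv
    exact GenAB.inChart_metricAB a β φ he hv
  have hb := hβ (e.symm u)
  rw [GenAB.formNorm_eq a β he hu] at hb
  rw [GenAB.meanLandsberg_congr hF,
    (GenAB.isConformalAt_of_isClosedConformal hc he hu).meanLandsberg_localF hφ hb hy]
  simp only [W, hl, ht, hs, GenAB.mv]
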